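/- Fix $n\ge 0$, $N=\mathbb Z^n$, $M=\operatorname{Hom}(N,\mathbb Z)=\mathbb Z^n$, and let $T=\operatorname{Spec}\mathbb C[M]\cong(\mathbb C^*)^n$. For an integer matrix $A=(a_{ij})$ with $\det A\neq 0$ let $f_A:T\to T$, $f_A(x_1,\dots,x_n)=\bigl(\prod_j x_j^{a_{1j}},\dots,\prod_j x_j^{a_{nj}}\bigr)$, be the associated monomial map; for a fan $\Delta$ in $N$ it extends to a rational map $f_A:X(\Delta)\dashrightarrow X(\Delta)$ on the complex toric variety $X(\Delta)$, which contains $T$ as a dense open subset and on which $T$ acts. Let $\mathbb Q^+\subset GL_n(\mathbb Q)$ be the subgroup of positive rational scalar matrices and $p:GL_n(\mathbb Q)\to GL_n(\mathbb Q)/\mathbb Q^+$ the projection. Let $\Delta$ be a complete fan in $N$ and let $G$ be a submonoid of $M_n(\mathbb Z)\cap GL_n(\mathbb Q)$ such that $p(G)$ is finite. Then there exist a fan $\Delta'$ in $N$ such that the toric variety $X(\Delta')$ is projective, and a birational morphism $\pi:X(\Delta')\to X(\Delta)$ over $\mathbb C$ which restricts to the identity on the torus $T$, such that for every $A\in G$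 the rational map $\pi^{-1}\circ f_A\circ\pi:X(\Delta')\dashrightarrow X(\Delta')$ is (the rational map of) a morphism $g:X(\Delta')\to X(\Delta')$ over $\mathbb C$ that is equivariant, i.e. $g(t\cdot x)=f_A(t)\cdot g(x)$ for all $t\in T(\mathbb C)$. -/

import Mathlib

open CategoryTheory CategoryTheory.Limits AlgebraicGeometry

namespace Toric

variable {n : ℕ}

/-- The inclusion of the lattice `ℤⁿ` into `ℝⁿ`. -/
def toReal (v : Fin n → ℤ) : Fin n → ℝ := fun i => (v i : ℝ)

/-- `σ` is generated, as a convex cone, by finitely many vectors of the lattice `ℤⁿ`. -/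
def IsRational (σ : PointedCone ℝ (Fin n → ℝ)) : Prop :=
  ∃ s : Finset (Fin n → ℤ), σ = PointedCone.hull ℝ (toReal '' (s : Set (Fin n → ℤ)))

/-- `σ` contains no line. -/
def IsStrictlyConvex (σ : PointedCone ℝ (Fin n → ℝ)) : Prop :=
  ∀ x ∈ σ, -x ∈ σ → x = 0

/-- `τ` is a face of `σ`: the intersection of `σ` with a hyperplane `u⊥` such that `u ≥ 0` on `σ`
(the case `u = 0` gives `σ` itself). -/
def IsFace (τ σ : PointedCone ℝ (Fin n → ℝ)) : Prop :=
  ∃ u : Fin n → ℝ, (∀ x ∈ σ, 0 ≤ u ⬝ᵥ x) ∧ ∀ x, x ∈ τ ↔ x ∈ σ ∧ u ⬝ᵥ x = 0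

/-- A fan in the lattice `N = ℤⁿ`. As `{0}` is a face of every strictly convex rational cone,
the condition `bot_mem` says just that the fan is not empty. -/
structure Fan (n : ℕ) where
  cones : Set (PointedCone ℝ (Fin n → ℝ))
  finite : cones.Finite
  rational : ∀ σ ∈ cones, IsRational σ
  strictlyConvex : ∀ σ ∈ cones, IsStrictlyConvex σ
  bot_mem : ⊥ ∈ cones
  face_mem : ∀ σ ∈ cones, ∀ τ, IsFace τ σ → τ ∈ cones
  inf_isFace : ∀ σ ∈ cones, ∀ τ ∈ cones, IsFace (σ ⊓ τ) σ ∧ IsFace (σ ⊓ τ) τ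

/-- The fan is complete: its support is the whole space. -/
def Fan.IsComplete (Δ : Fan n) : Prop := ∀ x : Fin n → ℝ, ∃ σ ∈ Δ.cones, x ∈ σ

/-- The semigroup `S_σ = σ^∨ ∩ M`, where `M = ℤⁿ` is the dual lattice. -/
def dualMonoid (σ : PointedCone ℝ (Fin n → ℝ)) : AddSubmonoid (Fin n → ℤ) where
  carrier := {m | ∀ x ∈ σ, 0 ≤ toReal m ⬝ᵥ x}
  zero_mem' := by
    intro x _
    simp [toReal, dotProduct]
  add_mem' := by
    intro a b ha hb x hx
    have : toReal (a + b) = toReal a + toReal b := by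
      ext i; simp [toReal]
    rw [this, add_dotProduct]
    exact add_nonneg (ha x hx) (hb x hx)

theorem dualMonoid_anti {τ σ : PointedCone ℝ (Fin n → ℝ)} (h : τ ≤ σ) :
    dualMonoid σ ≤ dualMonoid τ := fun _ hm x hx => hm x (h hx)

theorem toReal_dotProduct (m v : Fin n → ℤ) : toReal m ⬝ᵥ toReal v = ((m ⬝ᵥ v : ℤ) : ℝ) := by
  simp [toReal, dotProduct]

theorem dotProduct_nonneg_of_hull {s : Set (Fin n → ℝ)} {u : Fin n → ℝ}
    (h : ∀ v ∈ s, 0 ≤ u ⬝ᵥ v) {x : Fin n → ℝ} (hx : x ∈ PointedCone.hull ℝ s) : 0 ≤ u ⬝ᵥ x := by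
  refine Submodule.span_induction (p := fun x _ => 0 ≤ u ⬝ᵥ x) h (by simp) ?_ ?_ hx
  · intro x y _ _ hx hy
    rw [dotProduct_add]; exact add_nonneg hx hy
  · intro a x _ hx
    have : u ⬝ᵥ (a • x) = (a : ℝ) * (u ⬝ᵥ x) := by
      rw [← smul_eq_mul, ← dotProduct_smul]; rfl
    rw [this]; exact mul_nonneg a.2 hx

theorem exists_rat_functional (s : Finset (Fin n → ℤ)) (u : Fin n → ℝ) :
    ∃ q : Fin n → ℚ, ∀ v ∈ s, (u ⬝ᵥ toReal v = 0 → ∑ i, q i * (v i : ℚ) = 0) ∧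
      (0 < u ⬝ᵥ toReal v → 0 < ∑ i, q i * (v i : ℚ)) := by
  classical
  let W : Submodule ℚ ℝ := Submodule.span ℚ (Set.range u)
  have hW (i : Fin n) : u i ∈ W := Submodule.subset_span ⟨i, rfl⟩
  have : FiniteDimensional ℚ W := FiniteDimensional.span_of_finite ℚ (Set.finite_range u)
  let b := Module.finBasis ℚ W
  let w : Fin n → Fin (Module.finrank ℚ W) → ℚ := fun i k => b.repr ⟨u i, hW i⟩ k
  have hw (i : Fin n) : u i = ∑ k, (w i k : ℝ) * (b k : ℝ) := by
    have := congrArg (Subtype.val) (b.sum_repr ⟨u i, hW i⟩)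
    simp only [AddSubmonoidClass.coe_finsetSum, Submodule.coe_smul, Rat.smul_def] at this
    exact this.symm
  have hdot (c : Fin (Module.finrank ℚ W) → ℝ) (v : Fin n → ℤ) :
      ∑ i, (∑ k, (w i k : ℝ) * c k) * (v i : ℝ) = ∑ k, ((∑ i, w i k * v i : ℚ) : ℝ) * c k := by
    push_cast
    simp_rw [Finset.sum_mul]
    rw [Finset.sum_comm]
    refine Finset.sum_congr rfl fun k _ => Finset.sum_congr rfl fun i _ => by ring
  have hu (v : Fin n → ℤ) : u ⬝ᵥ toReal v = ∑ k, ((∑ i, w i k * v i : ℚ) : ℝ) * (b k : ℝ) := by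
    rw [← hdot]
    simp only [dotProduct, toReal]
    refine Finset.sum_congr rfl fun i _ => by rw [hw i]
  have hopen : IsOpen {c : Fin (Module.finrank ℚ W) → ℝ | ∀ v ∈ s, 0 < u ⬝ᵥ toReal v →
      0 < ∑ k, ((∑ i, w i k * v i : ℚ) : ℝ) * c k} := by
    have : {c : Fin (Module.finrank ℚ W) → ℝ | ∀ v ∈ s, 0 < u ⬝ᵥ toReal v →
      0 < ∑ k, ((∑ i, w i k * v i : ℚ) : ℝ) * c k} = ⋂ v ∈ s, {c | 0 < u ⬝ᵥ toReal v →
      0 < ∑ k, ((∑ i, w i k * v i : ℚ) : ℝ) * c k} := by ext c; simp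
    rw [this]
    refine isOpen_biInter_finset fun v _ => ?_
    by_cases h : 0 < u ⬝ᵥ toReal v
    · simp only [h, true_imp_iff]
      exact isOpen_lt continuous_const (by fun_prop)
    · simp [h]
  have hdense : DenseRange (fun (c : Fin (Module.finrank ℚ W) → ℚ) k => (c k : ℝ)) :=
    DenseRange.piMap (f := fun _ => ((↑) : ℚ → ℝ)) fun _ => Rat.denseRange_cast
  obtain ⟨c, hc⟩ := hdense.exists_mem_open hopen ⟨fun k => (b k : ℝ), fun v _ h => by rwa [← hu]⟩
  refine ⟨fun i => ∑ k, w i k * c k, fun v hv => ⟨fun h0 => ?_, fun hpos => ?_⟩⟩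
  · have key : ∀ k, (∑ i, w i k * v i : ℚ) = 0 := by
      have h1 : ∑ k, (∑ i, w i k * v i : ℚ) • b k = 0 := by
        apply Subtype.ext
        simp only [AddSubmonoidClass.coe_finsetSum, Submodule.coe_smul, Rat.smul_def,
          ZeroMemClass.coe_zero]
        rw [← hu, h0]
      exact Fintype.linearIndependent_iff.mp b.linearIndependent _ h1
    have := hdot (fun k => (c k : ℝ)) v
    simp only [key, Rat.cast_zero, zero_mul, Finset.sum_const_zero] at this
    exact_mod_cast this
  · have h1 := hc v hv hpos
    have := hdot (fun k => (c k : ℝ)) v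
    rw [← this] at h1
    exact_mod_cast h1

theorem exists_int_functional (s : Finset (Fin n → ℤ)) (u : Fin n → ℝ) :
    ∃ m : Fin n → ℤ, ∀ v ∈ s, (u ⬝ᵥ toReal v = 0 → m ⬝ᵥ v = 0) ∧
      (0 < u ⬝ᵥ toReal v → 0 < m ⬝ᵥ v) := by
  obtain ⟨q, hq⟩ := exists_rat_functional s u
  obtain ⟨d, hd⟩ := IsLocalization.exist_integer_multiples_of_finite (nonZeroDivisors ℤ) q
  choose m hm using hd
  have hd0 : ((d : ℤ) : ℚ) ≠ 0 := by
    exact_mod_cast nonZeroDivisors.ne_zero d.2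
  have hm' (i : Fin n) : (m i : ℚ) = (d : ℤ) * q i := by
    have := hm i
    simpa using this
  have hsum (v : Fin n → ℤ) : (((d : ℤ) * (m ⬝ᵥ v) : ℤ) : ℚ) =
      ((d : ℤ) : ℚ) ^ 2 * ∑ i, q i * (v i : ℚ) := by
    push_cast [dotProduct]
    simp_rw [hm', Finset.mul_sum]
    refine Finset.sum_congr rfl fun i _ => by ring
  have hd2 : 0 < ((d : ℤ) : ℚ) ^ 2 := by positivity
  refine ⟨(d : ℤ) • m, fun v hv => ⟨fun h => ?_, fun h => ?_⟩⟩
  · rw [smul_dotProduct, smul_eq_mul]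
    have := hsum v
    rw [(hq v hv).1 h, mul_zero] at this
    exact_mod_cast this
  · rw [smul_dotProduct, smul_eq_mul]
    have := hsum v
    have h2 := mul_pos hd2 ((hq v hv).2 h)
    rw [← this] at h2
    exact_mod_cast h2

/-- A face of a rational cone is cut out by an element of `σ^∨ ∩ M`. -/
theorem IsFace.exists_int {τ σ : PointedCone ℝ (Fin n → ℝ)} (hσ : IsRational σ)
    (h : IsFace τ σ) :
    ∃ m ∈ dualMonoid σ, ∀ x, x ∈ τ ↔ x ∈ σ ∧ toReal m ⬝ᵥ x = 0 := by
  obtain ⟨s, rfl⟩ := hσ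
  obtain ⟨u, hu, hτ⟩ := h
  obtain ⟨m, hm⟩ := exists_int_functional s u
  have hgen (v) (hv : v ∈ s) : toReal v ∈ PointedCone.hull ℝ (toReal '' (s : Set (Fin n → ℤ))) :=
    PointedCone.subset_hull ⟨v, hv, rfl⟩
  have hbound : ∀ x ∈ PointedCone.hull ℝ (toReal '' (s : Set (Fin n → ℤ))),
      0 ≤ toReal m ⬝ᵥ x ∧ (u ⬝ᵥ x = 0 ↔ toReal m ⬝ᵥ x = 0) := by
    intro x hx
    have hadd : ∀ {a b c d : ℝ}, 0 ≤ a → 0 ≤ b → 0 ≤ c → 0 ≤ d → (a = 0 ↔ c = 0) →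
        (b = 0 ↔ d = 0) → (a + b = 0 ↔ c + d = 0) := by
      intro a b c d ha hb hc hd h1 h2
      rw [add_eq_zero_iff_of_nonneg ha hb, add_eq_zero_iff_of_nonneg hc hd, h1, h2]
    refine (Submodule.span_induction
      (p := fun x _ => 0 ≤ u ⬝ᵥ x ∧ 0 ≤ toReal m ⬝ᵥ x ∧ (u ⬝ᵥ x = 0 ↔ toReal m ⬝ᵥ x = 0))
      ?_ (by simp) ?_ ?_ hx).2
    · rintro _ ⟨v, hv, rfl⟩
      have h0 := hu _ (hgen v hv)
      rcases h0.eq_or_lt with h0 | h0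
      · have := (hm v hv).1 h0.symm
        rw [toReal_dotProduct, this, ← h0]; simp
      · have := (hm v hv).2 h0
        have h3 : (0 : ℝ) < ((m ⬝ᵥ v : ℤ) : ℝ) := by exact_mod_cast this
        rw [toReal_dotProduct]
        exact ⟨h0.le, h3.le, by simp [h0.ne', h3.ne']⟩
    · rintro x y _ _ ⟨h1, h2, h3⟩ ⟨h4, h5, h6⟩
      simp only [dotProduct_add]
      exact ⟨add_nonneg h1 h4, add_nonneg h2 h5, hadd h1 h4 h2 h5 h3 h6⟩
    · rintro a x _ ⟨h1, h2, h3⟩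
      have e (u : Fin n → ℝ) : u ⬝ᵥ (a • x) = (a : ℝ) * (u ⬝ᵥ x) := by
        rw [← smul_eq_mul, ← dotProduct_smul]; rfl
      rw [e, e]
      exact ⟨mul_nonneg a.2 h1, mul_nonneg a.2 h2, by rw [mul_eq_zero, mul_eq_zero, h3]⟩
  refine ⟨m, fun x hx => (hbound x hx).1, fun x => ?_⟩
  rw [hτ]
  exact and_congr_right fun hx => (hbound x hx).2

/-- If the integral functional `m` cuts out the face `τ` of `σ`, then `S_τ = S_σ + ℕ (-m)`. -/
theorem exists_add_nsmul_mem {τ σ : PointedCone ℝ (Fin n → ℝ)} (hσ : IsRational σ)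
    {m : Fin n → ℤ} (hm : m ∈ dualMonoid σ) (hτ : ∀ x, x ∈ τ ↔ x ∈ σ ∧ toReal m ⬝ᵥ x = 0)
    {k : Fin n → ℤ} (hk : k ∈ dualMonoid τ) : ∃ N : ℕ, k + N • m ∈ dualMonoid σ := by
  obtain ⟨s, rfl⟩ := hσ
  have hgen (v) (hv : v ∈ s) : toReal v ∈ PointedCone.hull ℝ (toReal '' (s : Set (Fin n → ℤ))) :=
    PointedCone.subset_hull ⟨v, hv, rfl⟩
  refine ⟨∑ v ∈ s, (k ⬝ᵥ v).natAbs, fun x hx => dotProduct_nonneg_of_hull ?_ hx⟩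
  rintro _ ⟨v, hv, rfl⟩
  rw [toReal_dotProduct]
  have hmv : 0 ≤ m ⬝ᵥ v := by
    have := hm _ (hgen v hv)
    rw [toReal_dotProduct] at this
    exact_mod_cast this
  have hle : ((k ⬝ᵥ v).natAbs : ℤ) ≤ ((∑ v ∈ s, (k ⬝ᵥ v).natAbs : ℕ) : ℤ) := by
    exact_mod_cast Finset.single_le_sum (f := fun v => (k ⬝ᵥ v).natAbs)
      (fun _ _ => Nat.zero_le _) hv
  rw [Int.cast_nonneg_iff, add_dotProduct, smul_dotProduct, nsmul_eq_mul]
  rcases hmv.eq_or_lt with h0 | h0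
  · have : toReal v ∈ τ := (hτ _).2 ⟨hgen v hv, by rw [toReal_dotProduct, ← h0]; simp⟩
    have := hk _ this
    rw [toReal_dotProduct] at this
    rw [← h0, mul_zero, add_zero]
    exact_mod_cast this
  · have h1 : ((k ⬝ᵥ v).natAbs : ℤ) ≤
        ((∑ v ∈ s, (k ⬝ᵥ v).natAbs : ℕ) : ℤ) * (m ⬝ᵥ v) :=
      hle.trans (le_mul_of_one_le_right (by positivity) h0)
    have h2 := neg_abs_le (k ⬝ᵥ v)
    rw [← Int.natCast_natAbs] at h2
    simp only [Nat.cast_sum] at *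
    linarith
/-- The coordinate ring `ℂ[S_σ]` of the affine toric variety `U_σ`. -/
abbrev CoordRing (σ : PointedCone ℝ (Fin n → ℝ)) : Type := AddMonoidAlgebra ℂ (dualMonoid σ)

/-- The restriction `ℂ[S_σ] → ℂ[S_τ]`, `χ^m ↦ χ^m`, for `τ ⊆ σ`. -/
noncomputable def restr {τ σ : PointedCone ℝ (Fin n → ℝ)} (h : τ ≤ σ) :
    CoordRing σ →ₐ[ℂ] CoordRing τ :=
  AddMonoidAlgebra.mapDomainAlgHom ℂ ℂ (AddSubmonoid.inclusion (dualMonoid_anti h))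

theorem restr_single {τ σ : PointedCone ℝ (Fin n → ℝ)} (h : τ ≤ σ) (m : dualMonoid σ) (c : ℂ) :
    restr h (AddMonoidAlgebra.single m c) =
      AddMonoidAlgebra.single (AddSubmonoid.inclusion (dualMonoid_anti h) m) c := by
  simp [restr]

theorem restr_injective {τ σ : PointedCone ℝ (Fin n → ℝ)} (h : τ ≤ σ) :
    Function.Injective (restr h) :=
  AddMonoidAlgebra.mapDomain_injective (AddSubmonoid.inclusion_injective _)

theorem restr_refl (σ : PointedCone ℝ (Fin n → ℝ)) : restr (le_refl σ) = AlgHom.id ℂ _ :=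
  AddMonoidAlgebra.algHom_ext (fun m => by rw [restr_single]; rfl) (Subsingleton.elim _ _)

theorem restr_trans {ρ τ σ : PointedCone ℝ (Fin n → ℝ)} (h : ρ ≤ τ) (h' : τ ≤ σ) :
    restr (h.trans h') = (restr h).comp (restr h') :=
  AddMonoidAlgebra.algHom_ext
    (fun m => by rw [AlgHom.comp_apply, restr_single, restr_single, restr_single]; rfl)
    (Subsingleton.elim _ _)

/-- The coordinate ring `ℂ[M]` of the torus. -/
abbrev TorusRing (n : ℕ) : Type := AddMonoidAlgebra ℂ (Fin n → ℤ)

/-- The inclusion `ℂ[S_σ] → ℂ[M]`. -/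
noncomputable def toTorusRing (σ : PointedCone ℝ (Fin n → ℝ)) : CoordRing σ →ₐ[ℂ] TorusRing n :=
  AddMonoidAlgebra.mapDomainAlgHom ℂ ℂ (dualMonoid σ).subtype

theorem toTorusRing_injective (σ : PointedCone ℝ (Fin n → ℝ)) :
    Function.Injective (toTorusRing σ) :=
  AddMonoidAlgebra.mapDomain_injective Subtype.val_injective

instance (σ : PointedCone ℝ (Fin n → ℝ)) : IsDomain (CoordRing σ) :=
  (toTorusRing_injective σ).isDomain (toTorusRing σ).toRingHom

/-- For a face `τ` of `σ` cut out by `m ∈ S_σ`, the ring `ℂ[S_τ]` is the localization of `ℂ[S_σ]`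
at `χ^m`. -/
theorem isLocalization_restr {τ σ : PointedCone ℝ (Fin n → ℝ)} (hσ : IsRational σ) (h : τ ≤ σ)
    {m : Fin n → ℤ} (hm : m ∈ dualMonoid σ) (hτ : ∀ x, x ∈ τ ↔ x ∈ σ ∧ toReal m ⬝ᵥ x = 0) :
    letI := (restr h).toRingHom.toAlgebra
    IsLocalization.Away (AddMonoidAlgebra.single (⟨m, hm⟩ : dualMonoid σ) (1 : ℂ))
      (CoordRing τ) := by
  let := (restr h).toRingHom.toAlgebra
  have halg (z : CoordRing σ) : algebraMap (CoordRing σ) (CoordRing τ) z = restr h z := rfl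
  have hmτ : m ∈ dualMonoid τ := dualMonoid_anti h hm
  have hnτ : -m ∈ dualMonoid τ := by
    intro x hx
    have e : toReal (-m) = -toReal m := by ext i; simp [toReal]
    rw [e, neg_dotProduct, ((hτ x).1 hx).2, neg_zero]
  have hpow (N : ℕ) : restr h ((AddMonoidAlgebra.single (⟨m, hm⟩ : dualMonoid σ) (1 : ℂ)) ^ N) =
      AddMonoidAlgebra.single (N • (⟨m, hmτ⟩ : dualMonoid τ)) 1 := by
    rw [map_pow, restr_single, AddMonoidAlgebra.single_pow, one_pow]
    rfl
  refine ⟨?_, ?_, ?_⟩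
  · rintro ⟨_, N, rfl⟩
    rw [halg]
    dsimp only
    rw [map_pow]
    refine IsUnit.pow N ?_
    rw [restr_single]
    refine IsUnit.of_mul_eq_one (AddMonoidAlgebra.single (⟨-m, hnτ⟩ : dualMonoid τ) (1 : ℂ)) ?_
    rw [AddMonoidAlgebra.single_mul_single, AddMonoidAlgebra.one_def, mul_one]
    congr 1
    apply Subtype.ext
    simp
  · intro z
    suffices H : ∃ N : ℕ, ∃ y : CoordRing σ,
        z * AddMonoidAlgebra.single (N • (⟨m, hmτ⟩ : dualMonoid τ)) 1 = restr h y by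
      obtain ⟨N, y, hy⟩ := H
      exact ⟨(y, ⟨_, N, rfl⟩), by rw [halg, halg]; dsimp only; rw [hpow, hy]⟩
    induction z using AddMonoidAlgebra.induction_linear with
    | zero => exact ⟨0, 0, by simp⟩
    | add z w hz hw =>
      obtain ⟨N, y, hy⟩ := hz
      obtain ⟨N', y', hy'⟩ := hw
      refine ⟨N + N', y * (AddMonoidAlgebra.single (⟨m, hm⟩ : dualMonoid σ) (1 : ℂ)) ^ N' +
        y' * (AddMonoidAlgebra.single (⟨m, hm⟩ : dualMonoid σ) (1 : ℂ)) ^ N, ?_⟩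
      have e : AddMonoidAlgebra.single ((N + N') • (⟨m, hmτ⟩ : dualMonoid τ)) (1 : ℂ) =
          AddMonoidAlgebra.single (N • (⟨m, hmτ⟩ : dualMonoid τ)) (1 : ℂ) *
          AddMonoidAlgebra.single (N' • (⟨m, hmτ⟩ : dualMonoid τ)) (1 : ℂ) := by
        rw [AddMonoidAlgebra.single_mul_single, add_smul, mul_one]
      rw [map_add, map_mul, map_mul, hpow, hpow, ← hy, ← hy', e]
      ring
    | single k c =>
      obtain ⟨N, hN⟩ := exists_add_nsmul_mem hσ hm hτ k.2
      refine ⟨N, AddMonoidAlgebra.single ⟨_, hN⟩ c, ?_⟩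
      rw [restr_single, AddMonoidAlgebra.single_mul_single, mul_one]
      congr 1
  · intro x y hxy
    exact ⟨1, by rw [restr_injective h hxy]⟩

/-- The poset of cones of the fan, as a category. -/
abbrev Fan.Cone (Δ : Fan n) : Type := {σ : PointedCone ℝ (Fin n → ℝ) // σ ∈ Δ.cones}

theorem Fan.isFace_of_le (Δ : Fan n) {τ σ : Δ.Cone} (h : τ ≤ σ) : IsFace τ.1 σ.1 := by
  have := (Δ.inf_isFace τ.1 τ.2 σ.1 σ.2).2
  rwa [inf_eq_left.mpr (show τ.1 ≤ σ.1 from h)] at this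

/-- The affine toric variety `U_σ = Spec ℂ[S_σ]`. -/
noncomputable abbrev affine (σ : PointedCone ℝ (Fin n → ℝ)) : Scheme.{0} :=
  Spec (CommRingCat.of (CoordRing σ))

/-- The diagram of the affine toric varieties `U_σ = Spec ℂ[S_σ]`, for `σ ∈ Δ`, with the inclusions
`U_τ ⊆ U_σ` for `τ ⊆ σ`, that is, for the faces `τ` of `σ`. -/
noncomputable def Fan.diagram (Δ : Fan n) : Δ.Cone ⥤ Scheme.{0} where
  obj σ := affine σ.1
  map f := Spec.map (CommRingCat.ofHom (restr (leOfHom f)).toRingHom)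
  map_id σ := by rw [restr_refl]; exact Spec.map_id _
  map_comp f g := by
    rw [← Spec.map_comp, ← CommRingCat.ofHom_comp, restr_trans (leOfHom f) (leOfHom g)]
    rfl

theorem Fan.exists_map_isOpenImmersion_range (Δ : Fan n) {τ σ : Δ.Cone} (f : τ ⟶ σ) :
    ∃ (m : Fin n → ℤ) (hm : m ∈ dualMonoid σ.1),
      (∀ x, x ∈ τ.1 ↔ x ∈ σ.1 ∧ toReal m ⬝ᵥ x = 0) ∧ IsOpenImmersion (Δ.diagram.map f) ∧
      Set.range (Δ.diagram.map f) = (PrimeSpectrum.basicOpen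
        (AddMonoidAlgebra.single (⟨m, hm⟩ : dualMonoid σ.1) (1 : ℂ)) :
          Set (PrimeSpectrum (CoordRing σ.1))) := by
  obtain ⟨m, hm, hτ⟩ := (Δ.isFace_of_le (leOfHom f)).exists_int (Δ.rational _ σ.2)
  let := (restr (leOfHom f)).toRingHom.toAlgebra
  have := isLocalization_restr (Δ.rational _ σ.2) (leOfHom f) hm hτ
  exact ⟨m, hm, hτ, IsOpenImmersion.of_isLocalization
    (AddMonoidAlgebra.single (⟨m, hm⟩ : dualMonoid σ.1) (1 : ℂ)),
    PrimeSpectrum.localization_away_comap_range (CoordRing τ.1) _⟩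

instance (Δ : Fan n) {τ σ : Δ.Cone} (f : τ ⟶ σ) : IsOpenImmersion (Δ.diagram.map f) := by
  obtain ⟨_, _, _, h, _⟩ := Δ.exists_map_isOpenImmersion_range f
  exact h

instance (Δ : Fan n) : (Δ.diagram ⋙ Scheme.forget).IsLocallyDirected := by
  constructor
  intro τ τ' σ f f' x x' hxx'
  obtain ⟨m, hm, hτ, _, hr⟩ := Δ.exists_map_isOpenImmersion_range f
  obtain ⟨m', hm', hτ', _, hr'⟩ := Δ.exists_map_isOpenImmersion_range f'
  have hmem : τ.1 ⊓ τ'.1 ∈ Δ.cones := by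
    have h1 := (Δ.inf_isFace τ.1 τ.2 τ'.1 τ'.2).1
    exact Δ.face_mem _ τ.2 _ h1
  let ρ : Δ.Cone := ⟨τ.1 ⊓ τ'.1, hmem⟩
  let g : ρ ⟶ τ := homOfLE (show τ.1 ⊓ τ'.1 ≤ τ.1 from inf_le_left)
  let g' : ρ ⟶ τ' := homOfLE (show τ.1 ⊓ τ'.1 ≤ τ'.1 from inf_le_right)
  have hρ : ∀ y, y ∈ ρ.1 ↔ y ∈ σ.1 ∧ toReal (m + m') ⬝ᵥ y = 0 := by
    intro y
    have e : toReal (m + m') = toReal m + toReal m' := by ext i; simp [toReal]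
    rw [e, add_dotProduct]
    change y ∈ τ.1 ∧ y ∈ τ'.1 ↔ _
    rw [hτ, hτ']
    constructor
    · rintro ⟨⟨h1, h2⟩, -, h3⟩
      exact ⟨h1, by rw [h2, h3, add_zero]⟩
    · rintro ⟨h1, h2⟩
      have h3 := hm y h1
      have h4 := hm' y h1
      exact ⟨⟨h1, by linarith⟩, h1, by linarith⟩
  have hrρ : Set.range (Δ.diagram.map (g ≫ f)) = (PrimeSpectrum.basicOpen
        (AddMonoidAlgebra.single (⟨m + m', add_mem hm hm'⟩ : dualMonoid σ.1) (1 : ℂ)) :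
          Set (PrimeSpectrum (CoordRing σ.1))) := by
    let := (restr (leOfHom (g ≫ f))).toRingHom.toAlgebra
    have := isLocalization_restr (Δ.rational _ σ.2) (leOfHom (g ≫ f)) (add_mem hm hm') hρ
    exact PrimeSpectrum.localization_away_comap_range (CoordRing ρ.1) _
  have hprod : AddMonoidAlgebra.single (⟨m + m', add_mem hm hm'⟩ : dualMonoid σ.1) (1 : ℂ) =
      AddMonoidAlgebra.single (⟨m, hm⟩ : dualMonoid σ.1) (1 : ℂ) *
      AddMonoidAlgebra.single (⟨m', hm'⟩ : dualMonoid σ.1) (1 : ℂ) := by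
    rw [AddMonoidAlgebra.single_mul_single, mul_one]
    rfl
  change Δ.diagram.map f x = Δ.diagram.map f' x' at hxx'
  have hx : Δ.diagram.map f x ∈ Set.range (Δ.diagram.map (g ≫ f)) := by
    rw [hrρ, hprod, PrimeSpectrum.basicOpen_mul, TopologicalSpace.Opens.coe_inf, ← hr, ← hr']
    exact ⟨⟨x, rfl⟩, ⟨x', hxx'.symm⟩⟩
  obtain ⟨y, hy⟩ := hx
  refine ⟨ρ, g, g', y, ?_, ?_⟩
  · apply (Δ.diagram.map f).isOpenEmbedding.injective
    rw [← hy, Δ.diagram.map_comp]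
    rfl
  · apply (Δ.diagram.map f').isOpenEmbedding.injective
    rw [← hxx', ← hy, show g ≫ f = g' ≫ f' from Subsingleton.elim _ _, Δ.diagram.map_comp]
    rfl

/-- The toric variety `X(Δ)` over `ℂ`: the affine varieties `U_σ`, `σ ∈ Δ`, glued along their
common open subvarieties `U_(σ ∩ τ)`. -/
noncomputable def Fan.variety (Δ : Fan n) : Scheme.{0} := colimit Δ.diagram

/-- The open immersion `U_σ → X(Δ)`. -/
noncomputable def Fan.chart (Δ : Fan n) (σ : Δ.Cone) : affine σ.1 ⟶ Δ.variety :=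
  colimit.ι Δ.diagram σ

instance (Δ : Fan n) (σ : Δ.Cone) : IsOpenImmersion (Δ.chart σ) :=
  inferInstanceAs (IsOpenImmersion (colimit.ι Δ.diagram σ))

/-- The structure morphism `X(Δ) → Spec ℂ`. -/
noncomputable def Fan.toSpec (Δ : Fan n) : Δ.variety ⟶ Spec (CommRingCat.of ℂ) :=
  colimit.desc Δ.diagram
    { pt := Spec (CommRingCat.of ℂ)
      ι :=
        { app := fun σ => Spec.map (CommRingCat.ofHom (algebraMap ℂ (CoordRing σ.1)))
          naturality := fun τ σ f => by
            change Spec.map _ ≫ Spec.map _ = Spec.map _ ≫ 𝟙 _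
            rw [Category.comp_id, ← Spec.map_comp, ← CommRingCat.ofHom_comp]
            congr 2
            exact (restr (leOfHom f)).comp_algebraMap } }

/-- The torus `T = Spec ℂ[M]`. -/
noncomputable abbrev torus (n : ℕ) : Scheme.{0} := Spec (CommRingCat.of (TorusRing n))

/-- The zero cone of the fan. -/
def Fan.zeroCone (Δ : Fan n) : Δ.Cone := ⟨⊥, Δ.bot_mem⟩

theorem toTorusRing_bot_bijective :
    Function.Bijective (toTorusRing (⊥ : PointedCone ℝ (Fin n → ℝ))) := by
  refine ⟨toTorusRing_injective _, fun z => ?_⟩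
  induction z using AddMonoidAlgebra.induction_linear with
  | zero => exact ⟨0, map_zero _⟩
  | add z w hz hw =>
    obtain ⟨a, rfl⟩ := hz
    obtain ⟨b, rfl⟩ := hw
    exact ⟨a + b, map_add _ _ _⟩
  | single k c =>
    refine ⟨AddMonoidAlgebra.single ⟨k, ?_⟩ c, ?_⟩
    · intro x hx
      rw [(Submodule.mem_bot _).1 hx, dotProduct_zero]
    · simp [toTorusRing]

/-- The inclusion `T → U_σ`. -/
noncomputable def torusToAffine (σ : PointedCone ℝ (Fin n → ℝ)) :
    torus n ⟶ affine σ :=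
  Spec.map (CommRingCat.ofHom (toTorusRing σ).toRingHom)

/-- The inclusion of the torus `T = U_{0}` in `X(Δ)`. -/
noncomputable def Fan.torusι (Δ : Fan n) : torus n ⟶ Δ.variety :=
  torusToAffine ⊥ ≫ Δ.chart Δ.zeroCone

theorem toTorusRing_comp_restr {τ σ : PointedCone ℝ (Fin n → ℝ)} (h : τ ≤ σ) :
    (toTorusRing τ).comp (restr h) = toTorusRing σ :=
  AddMonoidAlgebra.algHom_ext
    (fun m => by rw [AlgHom.comp_apply, restr_single]; simp [toTorusRing])
    (Subsingleton.elim _ _)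

theorem torusToAffine_comp_map {Δ : Fan n} {τ σ : Δ.Cone} (f : τ ⟶ σ) :
    torusToAffine τ.1 ≫ Δ.diagram.map f = torusToAffine σ.1 := by
  change Spec.map _ ≫ Spec.map _ = Spec.map _
  rw [← Spec.map_comp, ← CommRingCat.ofHom_comp]
  congr 2
  exact congrArg AlgHom.toRingHom (toTorusRing_comp_restr (leOfHom f))

theorem Fan.torusι_eq (Δ : Fan n) (σ : Δ.Cone) : Δ.torusι = torusToAffine σ.1 ≫ Δ.chart σ := by
  have h : Δ.zeroCone ≤ σ := (bot_le : (⊥ : PointedCone ℝ (Fin n → ℝ)) ≤ σ.1)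
  have h1 : Δ.diagram.map (homOfLE h) ≫ Δ.chart σ = Δ.chart Δ.zeroCone :=
    colimit.w Δ.diagram (homOfLE h)
  rw [← torusToAffine_comp_map (homOfLE h)]
  exact (congrArg (torusToAffine _ ≫ ·) h1.symm).trans (Category.assoc _ _ _).symm

instance : IsIso (torusToAffine (⊥ : PointedCone ℝ (Fin n → ℝ))) := by
  have : IsIso (CommRingCat.ofHom
      (toTorusRing (⊥ : PointedCone ℝ (Fin n → ℝ))).toRingHom) :=
    (ConcreteCategory.isIso_iff_bijective _).2 toTorusRing_bot_bijective
  exact inferInstanceAs (IsIso (Spec.map (CommRingCat.ofHom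
      (toTorusRing (⊥ : PointedCone ℝ (Fin n → ℝ))).toRingHom)))

instance (Δ : Fan n) : IsOpenImmersion Δ.torusι := by
  have : IsIso (torusToAffine Δ.zeroCone.1) :=
    inferInstanceAs (IsIso (torusToAffine (⊥ : PointedCone ℝ (Fin n → ℝ))))
  have : IsOpenImmersion (torusToAffine Δ.zeroCone.1) := inferInstance
  exact IsOpenImmersion.comp (torusToAffine Δ.zeroCone.1) (Δ.chart Δ.zeroCone)

theorem isDominant_specMap {R S : Type} [CommRing R] [CommRing S] (f : R →+* S)
    (hf : Function.Injective f) : IsDominant (Spec.map (CommRingCat.ofHom f)) := by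
  constructor
  refine (PrimeSpectrum.denseRange_comap_iff_ker_le_nilRadical f).2 ?_
  rw [(RingHom.injective_iff_ker_eq_bot f).1 hf]
  exact bot_le

instance (Δ : Fan n) : IsDominant Δ.torusι := by
  constructor
  intro x
  obtain ⟨σ, y, rfl⟩ := Scheme.IsLocallyDirected.ι_jointly_surjective Δ.diagram x
  have hd : IsDominant (torusToAffine σ.1) := isDominant_specMap _ (toTorusRing_injective σ.1)
  have hy : y ∈ closure (Set.range (torusToAffine σ.1)) := hd.denseRange y
  have := image_closure_subset_closure_image (Δ.chart σ).continuous
    (Set.mem_image_of_mem _ hy)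
  refine closure_mono ?_ this
  rintro _ ⟨_, ⟨z, rfl⟩, rfl⟩
  refine ⟨z, ?_⟩
  rw [Δ.torusι_eq σ]
  rfl

instance : IrreducibleSpace (torus n) :=
  inferInstanceAs (IrreducibleSpace (PrimeSpectrum (TorusRing n)))

instance (Δ : Fan n) : IrreducibleSpace Δ.variety :=
  haveI : PreirreducibleSpace Δ.variety := by
    refine ⟨?_⟩
    rw [← Δ.torusι.denseRange.closure_range, ← Set.image_univ]
    exact ((IrreducibleSpace.isIrreducible_univ (torus n)).isPreirreducible.image _
      Δ.torusι.continuous.continuousOn).closure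
  ⟨⟨Δ.torusι (Classical.arbitrary (torus n))⟩⟩

/-- The value `t^m = ∏ tᵢ^(mᵢ)` of the character `χ^m` at the point `t` of `T(ℂ) = (ℂˣ)ⁿ`. -/
def character (t : Fin n → ℂˣ) : Multiplicative (Fin n → ℤ) →* ℂˣ where
  toFun m := ∏ i, t i ^ (m.toAdd i)
  map_one' := by simp
  map_mul' a b := by simp [zpow_add, Finset.prod_mul_distrib]

/-- The action of `t ∈ T(ℂ)` on functions on `U_σ`: `χ^m ↦ t^m χ^m`. -/
noncomputable def actRing (t : Fin n → ℂˣ) (σ : PointedCone ℝ (Fin n → ℝ)) :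
    CoordRing σ →ₐ[ℂ] CoordRing σ :=
  AddMonoidAlgebra.lift ℂ (CoordRing σ) (dualMonoid σ)
    { toFun := fun m => AddMonoidAlgebra.single m.toAdd
        (character t (Multiplicative.ofAdd (m.toAdd : Fin n → ℤ)) : ℂ)
      map_one' := by
        simp [AddMonoidAlgebra.one_def]
      map_mul' := fun a b => by
        simp [AddMonoidAlgebra.single_mul_single] }

theorem actRing_single (t : Fin n → ℂˣ) (σ : PointedCone ℝ (Fin n → ℝ)) (m : dualMonoid σ)
    (c : ℂ) : actRing t σ (AddMonoidAlgebra.single m c) =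
      AddMonoidAlgebra.single m (c * character t (Multiplicative.ofAdd (m : Fin n → ℤ))) := by
  simp [actRing]

theorem restr_comp_actRing (t : Fin n → ℂˣ) {τ σ : PointedCone ℝ (Fin n → ℝ)} (h : τ ≤ σ) :
    (restr h).comp (actRing t σ) = (actRing t τ).comp (restr h) :=
  AddMonoidAlgebra.algHom_ext
    (fun m => by
      rw [AlgHom.comp_apply, AlgHom.comp_apply, actRing_single, restr_single, restr_single,
        actRing_single]
      rfl)
    (Subsingleton.elim _ _)

/-- The action of a point `t` of the torus `T(ℂ) = (ℂˣ)ⁿ` on the toric variety `X(Δ)`. -/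
noncomputable def Fan.act (Δ : Fan n) (t : Fin n → ℂˣ) : Δ.variety ⟶ Δ.variety :=
  colimMap (F := Δ.diagram) (G := Δ.diagram)
    { app := fun σ => Spec.map (CommRingCat.ofHom (actRing t σ.1).toRingHom)
      naturality := fun τ σ f => by
        change Spec.map _ ≫ Spec.map _ = Spec.map _ ≫ Spec.map _
        rw [← Spec.map_comp, ← CommRingCat.ofHom_comp, ← Spec.map_comp, ← CommRingCat.ofHom_comp]
        congr 2
        exact congrArg AlgHom.toRingHom (restr_comp_actRing t (leOfHom f)) }

/-- The monoid `M_n(ℤ) ∩ GL_n(ℚ)` of integer matrices with nonzero determinant. -/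
def nonsingular (n : ℕ) : Submonoid (Matrix (Fin n) (Fin n) ℤ) where
  carrier := {A | A.det ≠ 0}
  one_mem' := by simp
  mul_mem' ha hb := by
    simp only [Set.mem_ofPred_eq, Matrix.det_mul] at *
    exact mul_ne_zero ha hb

/-- The inclusion of `M_n(ℤ) ∩ GL_n(ℚ)` in `GL_n(ℚ)`. -/
noncomputable def nonsingularToGL (n : ℕ) :
    nonsingular n →* Matrix.GeneralLinearGroup (Fin n) ℚ where
  toFun A := Matrix.GeneralLinearGroup.mkOfDetNeZero ((Int.castRingHom ℚ).mapMatrix A.1) (by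
    rw [← RingHom.map_det]
    exact (map_ne_zero_iff _ (RingHom.injective_int _)).2 A.2)
  map_one' := by
    apply Units.ext
    exact map_one (Int.castRingHom ℚ).mapMatrix
  map_mul' A B := by
    apply Units.ext
    exact map_mul (Int.castRingHom ℚ).mapMatrix A.1 B.1

/-- The subgroup `ℚ⁺` of positive scalar matrices of `GL_n(ℚ)`. -/
def posScalars (n : ℕ) : Subgroup (Matrix.GeneralLinearGroup (Fin n) ℚ) :=
  (Units.posSubgroup ℚ).map (Matrix.GeneralLinearGroup.scalar (Fin n))

instance : (posScalars n).Normal := by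
  constructor
  rintro _ ⟨q, hq, rfl⟩ g
  exact ⟨q, hq, by rw [← Matrix.GeneralLinearGroup.scalar_commute, mul_inv_cancel_right]⟩

/-- The projection `p : GL_n(ℚ) → PGL_n⁺(ℚ) = GL_n(ℚ) / ℚ⁺`, restricted to
`M_n(ℤ) ∩ GL_n(ℚ)`. -/
noncomputable def proj (n : ℕ) :
    nonsingular n →* Matrix.GeneralLinearGroup (Fin n) ℚ ⧸ posScalars n :=
  (QuotientGroup.mk' (posScalars n)).comp (nonsingularToGL n)

/-- The monomial map `f_A (t₁, …, tₙ) = (∏ⱼ tⱼ^(a₁ⱼ), …, ∏ⱼ tⱼ^(aₙⱼ))` on `T(ℂ) = (ℂˣ)ⁿ`. -/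
def monomialPoint (A : Matrix (Fin n) (Fin n) ℤ) (t : Fin n → ℂˣ) : Fin n → ℂˣ :=
  fun i => ∏ j, t j ^ A i j

/-- The effect of the monomial map `f_A` on functions: `f_A` pulls back the `i`-th coordinate to
`∏ⱼ xⱼ^(aᵢⱼ)`, so the character `χ^m` to `χ^(m A)`. -/
noncomputable def monomialRing (A : Matrix (Fin n) (Fin n) ℤ) : TorusRing n →ₐ[ℂ] TorusRing n :=
  AddMonoidAlgebra.mapDomainAlgHom ℂ ℂ (Matrix.vecMulLinear A).toAddMonoidHom

theorem monomialRing_injective (A : nonsingular n) :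
    Function.Injective (monomialRing A.1) := by
  refine AddMonoidAlgebra.mapDomain_injective fun a b hab => ?_
  change Matrix.vecMul a A.1 = Matrix.vecMul b A.1 at hab
  have h : Matrix.vecMul (a - b) A.1 = 0 := by rw [Matrix.sub_vecMul, hab, sub_self]
  by_contra hne
  exact A.2 (Matrix.exists_vecMul_eq_zero_iff.1 ⟨a - b, sub_ne_zero.2 hne, h⟩)

/-- The monomial map `f_A : T → T`. -/
noncomputable def monomialTorus (A : Matrix (Fin n) (Fin n) ℤ) : torus n ⟶ torus n :=
  Spec.map (CommRingCat.ofHom (monomialRing A).toRingHom)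

instance (A : nonsingular n) : IsDominant (monomialTorus A.1) :=
  isDominant_specMap _ (monomialRing_injective A)

/-- The rational map `f_A : X(Δ) ⤏ X(Δ)` which is the monomial map `f_A : T → T` on the dense open
torus `T`. -/
noncomputable def Fan.monomialMap (Δ : Fan n) (A : Matrix (Fin n) (Fin n) ℤ) :
    Δ.variety ⤏ Δ.variety :=
  Δ.torusι.partialIso.symm.toRationalMap.compHom (monomialTorus A ≫ Δ.torusι)

instance {X Y : Scheme.{0}} (e : X.PartialIso Y) : e.toRationalMap.IsDominant := by
  have : IsDominant e.target.ι := Opens.isDominant_ι e.dense_target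
  have : IsDominant e.toPartialMap.hom :=
    inferInstanceAs (IsDominant (e.iso.hom ≫ e.target.ι))
  infer_instance

instance (Δ : Fan n) (A : nonsingular n) : (Δ.monomialMap A.1).IsDominant := by
  unfold Fan.monomialMap
  have : IsDominant (monomialTorus A.1 ≫ Δ.torusι) := inferInstance
  rw [← Scheme.RationalMap.comp_toRationalMap]
  infer_instance

/-- `f : X(Δ₁) → X(Δ₂)` is equivariant with respect to the group homomorphism `f_A : T → T`:
`f (t x) = f_A(t) f(x)`. -/
def IsEquivariant {Δ₁ Δ₂ : Fan n} (A : Matrix (Fin n) (Fin n) ℤ) (f : Δ₁.variety ⟶ Δ₂.variety) :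
    Prop :=
  ∀ t : Fin n → ℂˣ, Δ₁.act t ≫ f = f ≫ Δ₂.act (monomialPoint A t)

section ProjectiveSpace

attribute [local instance] MvPolynomial.gradedAlgebra

/-- The projective space `ℙᵐ` over `ℂ`. -/
noncomputable def projectiveSpace (m : ℕ) : Scheme.{0} :=
  Proj (MvPolynomial.homogeneousSubmodule (Fin (m + 1)) ℂ)

/-- The structure morphism `ℙᵐ → Spec ℂ`. -/
noncomputable def projectiveSpaceToSpec (m : ℕ) : projectiveSpace m ⟶ Spec (CommRingCat.of ℂ) :=
  Proj.toSpecZero (MvPolynomial.homogeneousSubmodule (Fin (m + 1)) ℂ) ≫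
    Spec.map (CommRingCat.ofHom
      (algebraMap ℂ (MvPolynomial.homogeneousSubmodule (Fin (m + 1)) ℂ 0)))

end ProjectiveSpace

/-- `X(Δ)` is projective: it is isomorphic over `ℂ` to a closed subscheme of some `ℙᵐ`. -/
def Fan.IsProjective (Δ : Fan n) : Prop :=
  ∃ (m : ℕ) (i : Δ.variety ⟶ projectiveSpace m),
    IsClosedImmersion i ∧ i ≫ projectiveSpaceToSpec m = Δ.toSpec

end Toric

/-!
Let `H` be a finite set of integral functionals on `N`, and let `Δ'` be the fan of the closed cells
of the arrangement of the hyperplanes `a^⊥`, `a ∈ H` (`arrangementFan`). The set `H` is chosen such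
that it

* contains the coordinates, so that the cells contain no line;
* contains generators of `σ^∨ ∩ M` for all cones `σ` of `Δ`, so that no equation of a cone of `Δ`
  changes its sign on a cell and, `Δ` being complete, each cell lies in a cone of `Δ`
  (`exists_cell_le`);
* is invariant, up to positive multiples, under `a ↦ a A` for all `A ∈ G`, so that `A` maps each
  cell into a cell (`exists_mapsInto_cell`).

Such a set exists because `p(G)` is finite: a finite set with the first two properties is pulled
back along representatives of the elements of `p(G)` (`exists_finite_invariant`). By the second and
the third property, the identity of `N` is a map of fans `Δ' → Δ` and each `A ∈ G` is a map of fans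
`Δ' → Δ'`. Maps of fans induce toric morphisms (`IsFanMap.map`), which are equivariant and extend
the monomial maps of the torus. As the torus is dense, this determines the rational maps of the
statement (`conj_partialIsoOfDominant`).

The variety `X(Δ')` is projective since `Δ'` is the normal fan of the zonotope `∑ [-a, a]`
(`arrangementFan_isProjective`). The morphism to `ℙᵐ` is given by the characters of the vertices of
a large multiple of the zonotope and of generators of the monoids of the cells, translated to the
vertices. Over the set `D₊(x)`, for the coordinate `x` of a vertex, it is the closed immersion of
the affine chart of a cell. These sets cover the image, and the image is closed: if `x_b` is any
coordinate, then `b` is a rational convex combination of the vertices by Farkas' lemma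
(`exists_nsmul_mem_closure`), so on the image a power of `x_b` is a product of coordinates of
vertices; therefore, the complement of the sets `D₊(x)` is covered by the open sets on which one of
these binomials does not vanish, and they do not meet the image
(`ProjectiveEmbedding.isClosedImmersion`).
-/

namespace Toric

variable {n : ℕ}

/-! ### Lattice points of rational cones -/

/-- **Gordan's lemma**: the lattice points of a rational polyhedral cone given by finitely many
inequalities form a finitely generated monoid. -/
theorem exists_finset_closure_eq_of_dotProduct_nonneg {ι : Type*} [Finite ι]
    (a : ι → Fin n → ℤ) : ∃ S : Finset (Fin n → ℤ),
      ∀ v, v ∈ AddSubmonoid.closure (S : Set (Fin n → ℤ)) ↔ ∀ i, 0 ≤ a i ⬝ᵥ v := by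
  let c : (Fin n → ℕ) →+ (Fin n → ℤ) :=
    { toFun := fun p j => p j
      map_zero' := by ext; simp
      map_add' := by intros; ext; simp }
  let c' : (ι → ℕ) →+ (ι → ℤ) :=
    { toFun := fun p j => p j
      map_zero' := by ext; simp
      map_add' := by intros; ext; simp }
  let ev : (Fin n → ℤ) →+ (ι → ℤ) :=
    { toFun := fun v i => a i ⬝ᵥ v
      map_zero' := by ext; simp
      map_add' := by intros; ext; simp [dotProduct_add] }
  -- a lattice point `v` is written as `p - q`, the values of the inequalities as `y`
  let d : ((Fin n → ℕ) × (Fin n → ℕ)) × (ι → ℕ) →+ (Fin n → ℤ) :=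
    { toFun := fun p => c p.1.1 - c p.1.2
      map_zero' := by simp
      map_add' := by intros; simp only [Prod.fst_add, Prod.snd_add, map_add]; abel }
  let f : ((Fin n → ℕ) × (Fin n → ℕ)) × (ι → ℕ) →+ (ι → ℤ) := ev.comp d
  let g : ((Fin n → ℕ) × (Fin n → ℕ)) × (ι → ℕ) →+ (ι → ℤ) :=
    c'.comp (AddMonoidHom.snd _ _)
  obtain ⟨S, hS⟩ := (AddSubmonoid.fg_eqLocusM f g).map d
  refine ⟨S, fun v => ?_⟩
  rw [hS]
  constructor
  · rintro ⟨p, hp, rfl⟩ i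
    have : ev (d p) i = c' p.2 i := congrFun (show f p = g p from hp) i
    exact (Int.natCast_nonneg _).trans_eq this.symm
  · intro hv
    refine ⟨((fun j => (v j).toNat, fun j => (-v j).toNat), fun i => (a i ⬝ᵥ v).toNat), ?_, ?_⟩
    · have hd : d ((fun j => (v j).toNat, fun j => (-v j).toNat), fun i => (a i ⬝ᵥ v).toNat)
          = v := by
        ext j
        change ((v j).toNat : ℤ) - ((-v j).toNat : ℤ) = v j
        exact Int.toNat_sub_toNat_neg _
      change ev (d _) = c' _
      rw [hd]
      ext i
      exact (Int.toNat_of_nonneg (hv i)).symm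
    · ext j
      change ((v j).toNat : ℤ) - ((-v j).toNat : ℤ) = v j
      exact Int.toNat_sub_toNat_neg _

/-- A finitely generated rational cone is cut out by finitely many integral inequalities. The
generators are added one by one; the inequalities are updated by Fourier–Motzkin elimination. -/
theorem exists_finset_dual {κ : Type*} [Fintype κ] (V : Finset (κ → ℤ)) :
    ∃ F : Finset (κ → ℤ), (∀ f ∈ F, ∀ v ∈ V, 0 ≤ f ⬝ᵥ v) ∧
      ∀ b, (∀ f ∈ F, 0 ≤ f ⬝ᵥ b) →
        ∃ N : ℕ, 0 < N ∧ N • b ∈ AddSubmonoid.closure (V : Set (κ → ℤ)) := by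
  classical
  induction V using Finset.induction_on with
  | empty =>
    refine ⟨(Finset.univ.image fun j => Pi.single j 1) ∪
      (Finset.univ.image fun j => -Pi.single j 1), by simp, fun b hb => ⟨1, one_pos, ?_⟩⟩
    have : b = 0 := by
      ext j
      have h1 := hb (Pi.single j 1) (by simp)
      have h2 := hb (-Pi.single j 1) (by simp)
      simp only [single_one_dotProduct, neg_dotProduct, Pi.zero_apply] at *
      omega
    simp [this]
  | insert v V _ ih =>
    obtain ⟨F, hF, hFb⟩ := ih
    refine ⟨(F.filter fun f => 0 ≤ f ⬝ᵥ v) ∪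
      (F ×ˢ F).image (fun p => if 0 < p.1 ⬝ᵥ v ∧ p.2 ⬝ᵥ v < 0 then
        (p.1 ⬝ᵥ v) • p.2 - (p.2 ⬝ᵥ v) • p.1 else 0), ?_, ?_⟩
    · intro f hf w hw
      rw [Finset.mem_union, Finset.mem_filter, Finset.mem_image] at hf
      rw [Finset.mem_insert] at hw
      rcases hf with ⟨hf, hfv⟩ | ⟨⟨f, g⟩, hfg, rfl⟩
      · rcases hw with rfl | hw
        exacts [hfv, hF f hf w hw]
      · rw [Finset.mem_product] at hfg
        split_ifs with h
        · simp only [sub_dotProduct, smul_dotProduct, smul_eq_mul] at h ⊢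
          rcases hw with rfl | hw
          · exact (by ring : (f ⬝ᵥ w) * (g ⬝ᵥ w) - (g ⬝ᵥ w) * (f ⬝ᵥ w) = 0).ge
          · nlinarith [mul_nonneg h.1.le (hF g hfg.2 w hw),
              mul_nonneg (neg_nonneg.2 h.2.le) (hF f hfg.1 w hw)]
        · simp
    · intro b hb
      have h1 : ∀ f ∈ F, 0 ≤ f ⬝ᵥ v → 0 ≤ f ⬝ᵥ b := fun f hf hfv =>
        hb f (Finset.mem_union_left _ (Finset.mem_filter.2 ⟨hf, hfv⟩))
      have h2 : ∀ f ∈ F, ∀ g ∈ F, 0 < f ⬝ᵥ v → g ⬝ᵥ v < 0 →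
          0 ≤ (f ⬝ᵥ v) * (g ⬝ᵥ b) - (g ⬝ᵥ v) * (f ⬝ᵥ b) := by
        intro f hf g hg hfv hgv
        have := hb ((f ⬝ᵥ v) • g - (g ⬝ᵥ v) • f) (Finset.mem_union_right _
          (Finset.mem_image.2 ⟨(f, g), Finset.mk_mem_product hf hg, if_pos ⟨hfv, hgv⟩⟩))
        simpa only [sub_dotProduct, smul_dotProduct, smul_eq_mul] using this
      -- `k / N` is the least coefficient of `v` such that `b - (k / N) v` satisfies `F`
      obtain ⟨N, k, hN, hk⟩ : ∃ N k : ℕ, 0 < N ∧ ∀ f ∈ F, 0 ≤ f ⬝ᵥ (N • b - k • v) := by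
        by_cases hE : ∃ g ∈ F, g ⬝ᵥ v < 0 ∧ g ⬝ᵥ b < 0
        · obtain ⟨g, hg, hmax⟩ := Finset.exists_max_image
            (F.filter fun g => g ⬝ᵥ v < 0 ∧ g ⬝ᵥ b < 0)
            (fun g => (((g ⬝ᵥ b : ℤ) : ℚ) / (g ⬝ᵥ v : ℤ)))
            (by obtain ⟨g, hg, h⟩ := hE; exact ⟨g, Finset.mem_filter.2 ⟨hg, h⟩⟩)
          obtain ⟨hg, hgv, hgb⟩ := Finset.mem_filter.1 hg
          refine ⟨(-(g ⬝ᵥ v)).toNat, (-(g ⬝ᵥ b)).toNat, by omega, fun f hf => ?_⟩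
          have e1 : (((-(g ⬝ᵥ v)).toNat : ℕ) : ℤ) = -(g ⬝ᵥ v) := by omega
          have e2 : (((-(g ⬝ᵥ b)).toNat : ℕ) : ℤ) = -(g ⬝ᵥ b) := by omega
          rw [dotProduct_sub, dotProduct_smul, dotProduct_smul, nsmul_eq_mul, nsmul_eq_mul,
            e1, e2]
          rcases lt_trichotomy (f ⬝ᵥ v) 0 with hfv | hfv | hfv
          · by_cases hfb : f ⬝ᵥ b < 0
            · have := hmax f (Finset.mem_filter.2 ⟨hf, hfv, hfb⟩)
              have hf' : (((f ⬝ᵥ v : ℤ) : ℚ)) < 0 := by exact_mod_cast hfv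
              have hg' : (((g ⬝ᵥ v : ℤ) : ℚ)) < 0 := by exact_mod_cast hgv
              rw [div_le_iff_of_neg hf', div_mul_eq_mul_div, div_le_iff_of_neg hg'] at this
              have : (f ⬝ᵥ b) * (g ⬝ᵥ v) ≤ (g ⬝ᵥ b) * (f ⬝ᵥ v) := by exact_mod_cast this
              nlinarith
            · nlinarith
          · rw [hfv]
            have := h1 f hf hfv.ge
            nlinarith
          · have := h2 f hf g hg hfv hgv
            nlinarith
        · push Not at hE
          refine ⟨1, 0, one_pos, fun f hf => ?_⟩
          simp only [one_smul, zero_smul, sub_zero]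
          rcases lt_or_ge (f ⬝ᵥ v) 0 with h | h
          exacts [hE f hf h, h1 f hf h]
      obtain ⟨N', hN', hmem⟩ := hFb _ hk
      refine ⟨N' * N, Nat.mul_pos hN' hN, ?_⟩
      have hle : AddSubmonoid.closure (V : Set (κ → ℤ)) ≤
          AddSubmonoid.closure ((insert v V : Finset (κ → ℤ)) : Set (κ → ℤ)) :=
        AddSubmonoid.closure_mono (by simp)
      have hv : v ∈ AddSubmonoid.closure ((insert v V : Finset (κ → ℤ)) : Set (κ → ℤ)) :=
        AddSubmonoid.subset_closure (by simp)
      have e : (N' * N) • b = N' • (N • b - k • v) + (N' * k) • v := by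
        rw [smul_sub, mul_smul, mul_smul]; abel
      rw [e]
      exact add_mem (hle hmem) (nsmul_mem hv _)

/-- An integral form of **Farkas' lemma**. -/
theorem exists_nsmul_mem_closure {κ : Type*} [Fintype κ] (V : Finset (κ → ℤ)) (b : κ → ℤ)
    (h : ∀ f, (∀ v ∈ V, 0 ≤ f ⬝ᵥ v) → 0 ≤ f ⬝ᵥ b) :
    ∃ N : ℕ, 0 < N ∧ N • b ∈ AddSubmonoid.closure (V : Set (κ → ℤ)) := by
  obtain ⟨F, hF, hb⟩ := exists_finset_dual V
  exact hb b fun f hf => h f (hF f hf)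

theorem toReal_add (v w : Fin n → ℤ) : toReal (v + w) = toReal v + toReal w := by
  ext; simp [toReal]

theorem toReal_zero : toReal (0 : Fin n → ℤ) = 0 := by
  ext; simp [toReal]

theorem toReal_nsmul (k : ℕ) (v : Fin n → ℤ) : toReal (k • v) = (k : ℝ) • toReal v := by
  ext; simp [toReal]

theorem toReal_mem_of_mem_closure {σ : PointedCone ℝ (Fin n → ℝ)} {S : Set (Fin n → ℤ)}
    (h : ∀ v ∈ S, toReal v ∈ σ) {v : Fin n → ℤ} (hv : v ∈ AddSubmonoid.closure S) :
    toReal v ∈ σ := by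
  induction hv using AddSubmonoid.closure_induction with
  | mem v hv => exact h v hv
  | zero => rw [toReal_zero]; exact zero_mem _
  | add v w _ _ hv hw => rw [toReal_add]; exact add_mem hv hw

theorem dotProduct_cone_smul (u : Fin n → ℝ) (c : {c : ℝ // 0 ≤ c}) (x : Fin n → ℝ) :
    u ⬝ᵥ (c • x) = (c : ℝ) * (u ⬝ᵥ x) := by
  rw [← smul_eq_mul, ← dotProduct_smul]; rfl

theorem mem_of_nsmul_mem {σ : PointedCone ℝ (Fin n → ℝ)} {N : ℕ} (hN : 0 < N)
    {v : Fin n → ℤ} (h : toReal (N • v) ∈ σ) : toReal v ∈ σ := by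
  rw [toReal_nsmul] at h
  have hN' : (0 : ℝ) < N := by exact_mod_cast hN
  have := Submodule.smul_mem σ (⟨(N : ℝ)⁻¹, (inv_pos.2 hN').le⟩ : {c : ℝ // 0 ≤ c}) h
  have e : (⟨(N : ℝ)⁻¹, (inv_pos.2 hN').le⟩ : {c : ℝ // 0 ≤ c}) • ((N : ℝ) • toReal v) =
      toReal v := by
    change (N : ℝ)⁻¹ • ((N : ℝ) • toReal v) = toReal v
    rw [smul_smul, inv_mul_cancel₀ hN'.ne', one_smul]
  rwa [e] at this

/-- The monoid `σ^∨ ∩ M` of a rational cone is finitely generated. -/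
theorem IsRational.exists_closure_eq_dualMonoid {σ : PointedCone ℝ (Fin n → ℝ)}
    (hσ : IsRational σ) :
    ∃ T : Finset (Fin n → ℤ), AddSubmonoid.closure (T : Set (Fin n → ℤ)) = dualMonoid σ := by
  obtain ⟨s, rfl⟩ := hσ
  obtain ⟨T, hT⟩ := exists_finset_closure_eq_of_dotProduct_nonneg (fun v : s => v.1)
  refine ⟨T, AddSubmonoid.ext fun m => ?_⟩
  rw [hT]
  constructor
  · intro h x hx
    refine dotProduct_nonneg_of_hull (Set.forall_mem_image.2 fun v hv => ?_) hx
    rw [toReal_dotProduct, dotProduct_comm]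
    exact_mod_cast h ⟨v, hv⟩
  · intro h v
    have := h _ (PointedCone.subset_hull ⟨v.1, v.2, rfl⟩)
    rw [toReal_dotProduct, dotProduct_comm] at this
    exact_mod_cast this

/-- The lattice points of a rational cone are cut out by generators of `σ^∨ ∩ M`. -/
theorem IsRational.toReal_mem {σ : PointedCone ℝ (Fin n → ℝ)} (hσ : IsRational σ)
    {v : Fin n → ℤ} (h : ∀ m ∈ dualMonoid σ, 0 ≤ m ⬝ᵥ v) : toReal v ∈ σ := by
  obtain ⟨s, rfl⟩ := hσ
  obtain ⟨N, hN, hmem⟩ := exists_nsmul_mem_closure s v fun f hf => h f fun x hx =>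
    dotProduct_nonneg_of_hull (Set.forall_mem_image.2 fun v hv => by
      rw [toReal_dotProduct]
      exact_mod_cast hf v hv) hx
  exact mem_of_nsmul_mem hN (toReal_mem_of_mem_closure
    (fun _ hv => PointedCone.subset_hull (Set.mem_image_of_mem toReal hv)) hmem)

/-- The face of a finitely generated cone cut out by `u` is generated by the generators on
which `u` vanishes. -/
theorem mem_hull_sep {V : Set (Fin n → ℝ)} {u x : Fin n → ℝ} (hu : ∀ v ∈ V, 0 ≤ u ⬝ᵥ v)
    (hx : x ∈ PointedCone.hull ℝ V) (h0 : u ⬝ᵥ x = 0) :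
    x ∈ PointedCone.hull ℝ {v ∈ V | u ⬝ᵥ v = 0} := by
  revert h0
  refine Submodule.span_induction (p := fun x _ => u ⬝ᵥ x = 0 →
    x ∈ PointedCone.hull ℝ {v ∈ V | u ⬝ᵥ v = 0}) ?_ ?_ ?_ ?_ hx
  · exact fun v hv h0 => PointedCone.subset_hull ⟨hv, h0⟩
  · exact fun _ => zero_mem _
  · intro x y hx hy ihx ihy h0
    have h1 := dotProduct_nonneg_of_hull hu hx
    have h2 := dotProduct_nonneg_of_hull hu hy
    rw [dotProduct_add] at h0
    exact add_mem (ihx (by linarith)) (ihy (by linarith))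
  · intro c x _ ih h0
    rw [dotProduct_cone_smul, mul_eq_zero] at h0
    rcases h0 with h0 | h0
    · have : c = 0 := Subtype.ext h0
      rw [this, zero_smul]
      exact zero_mem _
    · exact Submodule.smul_mem _ c (ih h0)

/-! ### The fan of a hyperplane arrangement -/

section Arrangement

variable {ι : Type*}

theorem abs_eq_sign_mul_iff {R : Type*} [CommRing R] [LinearOrder R] [IsStrictOrderedRing R]
    (s : SignType) (y : R) : |y| = (s : R) * y ↔ 0 ≤ (s : R) * y ∧ (s = 0 → y = 0) := by
  cases s <;> simp [abs_eq_self, abs_eq_neg_self]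

theorem sign_mul_le_abs {R : Type*} [CommRing R] [LinearOrder R] [IsStrictOrderedRing R]
    (s : SignType) (y : R) : (s : R) * y ≤ |y| := by
  cases s <;> simp [le_abs_self, neg_le_abs]

/-- The lattice points of the closed cell with sign vector `s` of the arrangement of the
hyperplanes `aᵢ^⊥`. The condition `|y| = sᵢ y` says that `y ≥ 0`, `y = 0`, `y ≤ 0` for `sᵢ = 1`,
`0`, `-1`. -/
def cellPoints (a : ι → Fin n → ℤ) (s : ι → SignType) : AddSubmonoid (Fin n → ℤ) where
  carrier := {v | ∀ i, |a i ⬝ᵥ v| = (s i : ℤ) * (a i ⬝ᵥ v)}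
  zero_mem' := by simp
  add_mem' := by
    intro v w hv hw i
    rw [dotProduct_add]
    refine le_antisymm ((abs_add_le _ _).trans ?_) (sign_mul_le_abs _ _)
    rw [hv i, hw i, mul_add]

theorem mem_cellPoints {a : ι → Fin n → ℤ} {s : ι → SignType} {v : Fin n → ℤ} :
    v ∈ cellPoints a s ↔ ∀ i, |a i ⬝ᵥ v| = (s i : ℤ) * (a i ⬝ᵥ v) := Iff.rfl

theorem mem_cellPoints_sign (a : ι → Fin n → ℤ) (v : Fin n → ℤ) :
    v ∈ cellPoints a fun i => SignType.sign (a i ⬝ᵥ v) := fun _ => (sign_mul_self _).symm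

/-- The closed cell with sign vector `s` of the arrangement of the hyperplanes `aᵢ^⊥`. It may be
the cell of several sign vectors, as no point need realize the signs `s` strictly. -/
def cell (a : ι → Fin n → ℤ) (s : ι → SignType) : PointedCone ℝ (Fin n → ℝ) :=
  PointedCone.hull ℝ (toReal '' (cellPoints a s : Set (Fin n → ℤ)))

theorem toReal_mem_cell {a : ι → Fin n → ℤ} {s : ι → SignType} {v : Fin n → ℤ}
    (hv : v ∈ cellPoints a s) : toReal v ∈ cell a s :=
  PointedCone.subset_hull (Set.mem_image_of_mem toReal hv)

theorem abs_dotProduct_of_mem_cell {a : ι → Fin n → ℤ} {s : ι → SignType} {x : Fin n → ℝ}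
    (hx : x ∈ cell a s) (i : ι) :
    |toReal (a i) ⬝ᵥ x| = (s i : ℝ) * (toReal (a i) ⬝ᵥ x) := by
  refine Submodule.span_induction
    (p := fun x _ => |toReal (a i) ⬝ᵥ x| = (s i : ℝ) * (toReal (a i) ⬝ᵥ x)) ?_ ?_ ?_ ?_ hx
  · rintro _ ⟨v, hv, rfl⟩
    have := congrArg (Int.cast (R := ℝ)) (hv i)
    rw [toReal_dotProduct]
    push_cast at this
    exact this
  · simp
  · intro x y _ _ hx hy
    rw [dotProduct_add]
    refine le_antisymm ((abs_add_le _ _).trans ?_) (sign_mul_le_abs _ _)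
    rw [hx, hy, mul_add]
  · intro c x _ hx
    rw [dotProduct_cone_smul, abs_mul, hx, abs_of_nonneg c.2]
    ring

variable [Fintype ι]

theorem cell_isRational (a : ι → Fin n → ℤ) (s : ι → SignType) : IsRational (cell a s) := by
  let b : ι ⊕ ι ⊕ ι → Fin n → ℤ := Sum.elim (fun i => (s i : ℤ) • a i)
    (Sum.elim (fun i => (1 - (s i : ℤ) ^ 2) • a i) fun i => -((1 - (s i : ℤ) ^ 2) • a i))
  obtain ⟨S, hS⟩ := exists_finset_closure_eq_of_dotProduct_nonneg b
  have key : ∀ v, v ∈ AddSubmonoid.closure (S : Set (Fin n → ℤ)) ↔ v ∈ cellPoints a s := by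
    intro v
    rw [hS]
    simp only [b, Sum.forall, Sum.elim_inl, Sum.elim_inr, neg_dotProduct, smul_dotProduct,
      smul_eq_mul, neg_nonneg, mem_cellPoints, abs_eq_sign_mul_iff]
    rw [← forall_and, ← forall_and]
    refine forall_congr' fun i => ?_
    rw [← le_antisymm_iff, eq_comm]
    cases s i <;> simp
  refine ⟨S, le_antisymm (Submodule.span_le.2 ?_) (Submodule.span_mono (Set.image_mono ?_))⟩
  · rintro _ ⟨v, hv, rfl⟩
    exact toReal_mem_of_mem_closure
      (fun _ hv => PointedCone.subset_hull (Set.mem_image_of_mem toReal hv)) ((key v).2 hv)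
  · exact fun v hv => (key v).1 (AddSubmonoid.subset_closure hv)

/-- A submonoid of lattice points of a cell has a generic element: it lies on no hyperplane of the
arrangement but those that contain the submonoid. -/
theorem exists_generic {a : ι → Fin n → ℤ} {s : ι → SignType} {W : AddSubmonoid (Fin n → ℤ)}
    (hW : W ≤ cellPoints a s) :
    ∃ w ∈ W, ∀ i, a i ⬝ᵥ w = 0 → ∀ v ∈ W, a i ⬝ᵥ v = 0 := by
  classical
  have : ∀ i, ∃ w ∈ W, a i ⬝ᵥ w = 0 → ∀ v ∈ W, a i ⬝ᵥ v = 0 := fun i => by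
    by_cases h : ∃ w ∈ W, a i ⬝ᵥ w ≠ 0
    · obtain ⟨w, hw, h0⟩ := h
      exact ⟨w, hw, fun h => absurd h h0⟩
    · push Not at h
      exact ⟨0, W.zero_mem, fun _ => h⟩
  choose w hw hwi using this
  refine ⟨∑ i, w i, sum_mem fun i _ => hw i, fun i h0 => hwi i ?_⟩
  rw [dotProduct_sum] at h0
  have h1 : ∑ j, |a i ⬝ᵥ w j| = 0 := by
    rw [Finset.sum_congr rfl fun j _ => mem_cellPoints.1 (hW (hw j)) i, ← Finset.mul_sum, h0,
      mul_zero]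
  exact abs_eq_zero.1 ((Finset.sum_eq_zero_iff_of_nonneg fun j _ => abs_nonneg _).1 h1 i
    (Finset.mem_univ i))

/-- The vertex of the zonotope `∑ᵢ [-aᵢ, aᵢ]` at which the functionals in the cell with sign
vector `s` attain their minimum. -/
def cellVertex (a : ι → Fin n → ℤ) (s : ι → SignType) : Fin n → ℤ := -∑ i, (s i : ℤ) • a i

theorem cellVertex_sub_dotProduct {a : ι → Fin n → ℤ} {s : ι → SignType} (t : ι → SignType)
    {x : Fin n → ℝ} (hx : x ∈ cell a s) :
    toReal (cellVertex a t - cellVertex a s) ⬝ᵥ x =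
      ∑ i, (|toReal (a i) ⬝ᵥ x| - (t i : ℝ) * (toReal (a i) ⬝ᵥ x)) := by
  have e : toReal (cellVertex a t - cellVertex a s) =
      ∑ i, ((s i : ℝ) - (t i : ℝ)) • toReal (a i) := by
    ext j
    simp only [toReal, cellVertex, Pi.sub_apply, Pi.neg_apply, Finset.sum_apply, Pi.smul_apply,
      smul_eq_mul]
    push_cast
    simp only [sub_mul, Finset.sum_sub_distrib]
    ring
  rw [e, sum_dotProduct]
  refine Finset.sum_congr rfl fun i _ => ?_
  rw [smul_dotProduct, smul_eq_mul, sub_mul, abs_dotProduct_of_mem_cell hx]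

theorem cellVertex_sub_mem_dualMonoid (a : ι → Fin n → ℤ) (s t : ι → SignType) :
    cellVertex a t - cellVertex a s ∈ dualMonoid (cell a s) := fun x hx => by
  rw [cellVertex_sub_dotProduct t hx]
  exact Finset.sum_nonneg fun i _ => sub_nonneg.2 (sign_mul_le_abs _ _)

/-- The difference of the vertices of two cells cuts out their intersection. -/
theorem mem_cell_of_cellVertex_sub {a : ι → Fin n → ℤ} {s t : ι → SignType} {x : Fin n → ℝ}
    (hx : x ∈ cell a s) (h0 : toReal (cellVertex a t - cellVertex a s) ⬝ᵥ x = 0) :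
    x ∈ cell a t := by
  have := mem_hull_sep (Set.forall_mem_image.2 fun v hv =>
    cellVertex_sub_mem_dualMonoid a s t _ (toReal_mem_cell hv)) hx h0
  refine Submodule.span_mono ?_ this
  rintro _ ⟨⟨v, hv, rfl⟩, hv0⟩
  refine ⟨v, fun i => ?_, rfl⟩
  rw [cellVertex_sub_dotProduct t (toReal_mem_cell hv),
    Finset.sum_eq_zero_iff_of_nonneg fun i _ => sub_nonneg.2 (sign_mul_le_abs _ _)] at hv0
  have := hv0 i (Finset.mem_univ i)
  rw [sub_eq_zero, toReal_dotProduct] at this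
  have h : ((|a i ⬝ᵥ v| : ℤ) : ℝ) = (((t i : ℤ) * (a i ⬝ᵥ v) : ℤ) : ℝ) := by
    push_cast
    exact this
  exact_mod_cast h

theorem cell_inf_isFace (a : ι → Fin n → ℤ) (s t : ι → SignType) :
    IsFace (cell a s ⊓ cell a t) (cell a s) := by
  refine ⟨toReal (cellVertex a t - cellVertex a s), cellVertex_sub_mem_dualMonoid a s t,
    fun x => ⟨fun hx => ⟨hx.1, ?_⟩, fun hx => ⟨hx.1, mem_cell_of_cellVertex_sub hx.1 hx.2⟩⟩⟩
  rw [cellVertex_sub_dotProduct t hx.1]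
  exact Finset.sum_eq_zero fun i _ => sub_eq_zero.2 (abs_dotProduct_of_mem_cell hx.2 i)

/-- A face of a cell is a cell: the signs of the hyperplanes that contain the face are replaced
by `0`. -/
theorem IsFace.exists_eq_cell {a : ι → Fin n → ℤ} {s : ι → SignType}
    {τ : PointedCone ℝ (Fin n → ℝ)} (h : IsFace τ (cell a s)) : ∃ t, τ = cell a t := by
  classical
  obtain ⟨m, hm, hτ⟩ := h.exists_int (cell_isRational a s)
  have hm' : ∀ v ∈ cellPoints a s, 0 ≤ m ⬝ᵥ v := fun v hv => by
    have := hm _ (toReal_mem_cell hv)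
    rw [toReal_dotProduct] at this
    exact_mod_cast this
  let W : AddSubmonoid (Fin n → ℤ) :=
    { carrier := {v | v ∈ cellPoints a s ∧ m ⬝ᵥ v = 0}
      zero_mem' := ⟨zero_mem _, dotProduct_zero _⟩
      add_mem' := fun hv hw => ⟨add_mem hv.1 hw.1, by rw [dotProduct_add, hv.2, hw.2, add_zero]⟩ }
  obtain ⟨w, hw, hgen⟩ := exists_generic (W := W) (a := a) (s := s) fun v hv => hv.1
  let t : ι → SignType := fun i => if a i ⬝ᵥ w = 0 then 0 else s i
  refine ⟨t, le_antisymm (fun x hx => ?_) (Submodule.span_le.2 ?_)⟩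
  · obtain ⟨hx, h0⟩ := (hτ x).1 hx
    have := mem_hull_sep (Set.forall_mem_image.2 fun v hv => hm _ (toReal_mem_cell hv)) hx h0
    refine Submodule.span_mono ?_ this
    rintro _ ⟨⟨v, hv, rfl⟩, hv0⟩
    rw [toReal_dotProduct] at hv0
    refine ⟨v, fun i => ?_, rfl⟩
    by_cases hi : a i ⬝ᵥ w = 0
    · rw [hgen i hi v ⟨hv, by exact_mod_cast hv0⟩]
      simp
    · simp only [t, if_neg hi]
      exact hv i
  · rintro _ ⟨v, hv, rfl⟩
    have hvs : v ∈ cellPoints a s := fun i => by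
      have := hv i
      by_cases hi : a i ⬝ᵥ w = 0
      · simp only [t, if_pos hi, SignType.coe_zero, zero_mul, abs_eq_zero] at this
        simp [this]
      · simpa only [t, if_neg hi] using this
    refine (hτ _).2 ⟨toReal_mem_cell hvs, ?_⟩
    -- `w` lies in the relative interior of the face, so `N w - v` is in the cell for large `N`
    have hmem : (∑ j, |a j ⬝ᵥ v|) • w - v ∈ cellPoints a s := fun i => by
      have hle : |a i ⬝ᵥ v| ≤ ∑ j, |a j ⬝ᵥ v| :=
        Finset.single_le_sum (f := fun j => |a j ⬝ᵥ v|) (fun j _ => abs_nonneg _)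
          (Finset.mem_univ i)
      have h1 := (abs_eq_sign_mul_iff _ _).1 (hvs i)
      have h2 := (abs_eq_sign_mul_iff _ _).1 (hw.1 i)
      rw [dotProduct_sub, dotProduct_smul, smul_eq_mul, abs_eq_sign_mul_iff]
      refine ⟨?_, fun h => by rw [h1.2 h, h2.2 h]; simp⟩
      have h4 := hv i
      by_cases hi : a i ⬝ᵥ w = 0
      · simp only [t, if_pos hi, SignType.coe_zero, zero_mul, abs_eq_zero] at h4
        simp [hi, h4]
      · have h3 : 1 ≤ (s i : ℤ) * (a i ⬝ᵥ w) := by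
          rw [← hw.1 i]
          exact Int.one_le_abs hi
        have h5 : (∑ j, |a j ⬝ᵥ v|) ≤ (∑ j, |a j ⬝ᵥ v|) * ((s i : ℤ) * (a i ⬝ᵥ w)) :=
          le_mul_of_one_le_right ((abs_nonneg _).trans hle) h3
        have h6 := hvs i
        linarith [mul_sub (s i : ℤ) ((∑ j, |a j ⬝ᵥ v|) * (a i ⬝ᵥ w)) (a i ⬝ᵥ v),
          mul_left_comm (s i : ℤ) (∑ j, |a j ⬝ᵥ v|) (a i ⬝ᵥ w)]
    have h1 := hm' _ hmem
    rw [dotProduct_sub, dotProduct_smul, hw.2, smul_zero, zero_sub] at h1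
    rw [toReal_dotProduct, le_antisymm (neg_nonneg.1 h1) (hm' v hvs), Int.cast_zero]

/-- The fan of the closed cells of the arrangement of the hyperplanes `aᵢ^⊥`, where the `aᵢ` have
no common zero but the origin. -/
def arrangementFan (a : ι → Fin n → ℤ)
    (ha : ∀ x : Fin n → ℝ, (∀ i, toReal (a i) ⬝ᵥ x = 0) → x = 0) : Fan n where
  cones := Set.range (cell a)
  finite := Set.finite_range _
  rational := by rintro _ ⟨s, rfl⟩; exact cell_isRational a s
  strictlyConvex := by
    rintro _ ⟨s, rfl⟩ x hx hx'
    refine ha x fun i => abs_eq_zero.1 ?_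
    have h1 := abs_dotProduct_of_mem_cell hx i
    have h2 := abs_dotProduct_of_mem_cell hx' i
    rw [dotProduct_neg, abs_neg, mul_neg] at h2
    linarith
  bot_mem := by
    refine ⟨0, (Submodule.eq_bot_iff _).2 fun x hx => ha x fun i => abs_eq_zero.1 ?_⟩
    simpa using abs_dotProduct_of_mem_cell hx i
  face_mem := by
    rintro _ ⟨s, rfl⟩ τ hτ
    obtain ⟨t, rfl⟩ := hτ.exists_eq_cell
    exact ⟨t, rfl⟩
  inf_isFace := by
    rintro _ ⟨s, rfl⟩ _ ⟨t, rfl⟩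
    exact ⟨cell_inf_isFace a s t, inf_comm (cell a s) (cell a t) ▸ cell_inf_isFace a t s⟩

/-- If the cones of a complete fan are cut out by hyperplanes of the arrangement, then the
arrangement refines the fan. -/
theorem exists_cell_le {Δ : Fan n} (hΔ : Δ.IsComplete) {a : ι → Fin n → ℤ}
    (ha : ∀ σ ∈ Δ.cones, ∃ T : Set (Fin n → ℤ), T ⊆ Set.range a ∧
      AddSubmonoid.closure T = dualMonoid σ) (s : ι → SignType) :
    ∃ σ ∈ Δ.cones, cell a s ≤ σ := by
  -- no functional of `ha` changes its sign on the cell, so the cone of a generic point will do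
  obtain ⟨w, hw, hgen⟩ := exists_generic (le_refl (cellPoints a s))
  obtain ⟨σ, hσ, hwσ⟩ := hΔ (toReal w)
  refine ⟨σ, hσ, Submodule.span_le.2 ?_⟩
  rintro _ ⟨v, hv, rfl⟩
  obtain ⟨T, hTa, hT⟩ := ha σ hσ
  refine (Δ.rational σ hσ).toReal_mem fun m hm => ?_
  rw [← hT] at hm
  induction hm using AddSubmonoid.closure_induction with
  | mem m hm =>
    have hmσ : m ∈ dualMonoid σ := hT ▸ AddSubmonoid.subset_closure hm
    obtain ⟨i, rfl⟩ := hTa hm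
    have h1 : 0 ≤ a i ⬝ᵥ w := by
      have := hmσ _ hwσ
      rw [toReal_dotProduct] at this
      exact_mod_cast this
    rcases h1.eq_or_lt with h1 | h1
    · exact (hgen i h1.symm v hv).ge
    · have h2 := hw i
      have h3 := hv i
      rw [abs_of_pos h1] at h2
      have h4 : (s i : ℤ) = 1 := (mul_eq_right₀ h1.ne').1 h2.symm
      rw [h4, one_mul] at h3
      exact abs_eq_self.1 h3
  | zero => simp
  | add m m' _ _ h h' => rw [add_dotProduct]; exact add_nonneg h h'

end Arrangement

/-! ### Toric morphisms -/

/-- The linear map with matrix `A` maps the cone `σ` into the cone `τ`. -/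
def MapsInto (A : Matrix (Fin n) (Fin n) ℤ) (σ τ : PointedCone ℝ (Fin n → ℝ)) : Prop :=
  ∀ x ∈ σ, (A.map (Int.cast : ℤ → ℝ)).mulVec x ∈ τ

theorem toReal_vecMul_dotProduct (A : Matrix (Fin n) (Fin n) ℤ) (m : Fin n → ℤ)
    (x : Fin n → ℝ) :
    toReal (Matrix.vecMul m A) ⬝ᵥ x = toReal m ⬝ᵥ (A.map (Int.cast : ℤ → ℝ)).mulVec x := by
  have : toReal (Matrix.vecMul m A) = Matrix.vecMul (toReal m) (A.map (Int.cast : ℤ → ℝ)) := by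
    ext j
    simp [toReal, Matrix.vecMul, dotProduct]
  rw [this, Matrix.dotProduct_mulVec]

theorem mulVec_toReal (A : Matrix (Fin n) (Fin n) ℤ) (v : Fin n → ℤ) :
    (A.map (Int.cast : ℤ → ℝ)).mulVec (toReal v) = toReal (A.mulVec v) := by
  ext j
  simp [toReal, Matrix.mulVec, dotProduct]

variable {A : Matrix (Fin n) (Fin n) ℤ} {σ τ : PointedCone ℝ (Fin n → ℝ)}

/-- The homomorphism `S_τ → S_σ`, `m ↦ m A`, for `A σ ⊆ τ`. -/
def MapsInto.dual (h : MapsInto A σ τ) : dualMonoid τ →+ dualMonoid σ where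
  toFun m := ⟨Matrix.vecMul m.1 A, fun x hx => by
    rw [toReal_vecMul_dotProduct]
    exact m.2 _ (h x hx)⟩
  map_zero' := Subtype.ext (Matrix.zero_vecMul A)
  map_add' m m' := Subtype.ext (Matrix.add_vecMul A m.1 m'.1)

/-- The homomorphism `ℂ[S_τ] → ℂ[S_σ]`, `χ^m ↦ χ^(m A)`, for `A σ ⊆ τ`. -/
noncomputable def MapsInto.ring (h : MapsInto A σ τ) : CoordRing τ →ₐ[ℂ] CoordRing σ :=
  AddMonoidAlgebra.mapDomainAlgHom ℂ ℂ h.dual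

theorem MapsInto.ring_single (h : MapsInto A σ τ) (m : dualMonoid τ) (c : ℂ) :
    h.ring (AddMonoidAlgebra.single m c) = AddMonoidAlgebra.single (h.dual m) c := by
  simp [MapsInto.ring]

/-- The morphism `U_σ → U_τ` given by the monomial map `f_A`, for `A σ ⊆ τ`. -/
noncomputable def MapsInto.map (h : MapsInto A σ τ) : affine σ ⟶ affine τ :=
  Spec.map (CommRingCat.ofHom h.ring.toRingHom)

theorem specMap_comp_eq {R S S' T : Type} [CommRing R] [CommRing S] [CommRing S'] [CommRing T]
    [Algebra ℂ R] [Algebra ℂ S] [Algebra ℂ S'] [Algebra ℂ T]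
    {f : R →ₐ[ℂ] S} {g : S →ₐ[ℂ] T} {f' : R →ₐ[ℂ] S'} {g' : S' →ₐ[ℂ] T}
    (h : g.comp f = g'.comp f') :
    Spec.map (CommRingCat.ofHom g.toRingHom) ≫ Spec.map (CommRingCat.ofHom f.toRingHom) =
      Spec.map (CommRingCat.ofHom g'.toRingHom) ≫ Spec.map (CommRingCat.ofHom f'.toRingHom) := by
  rw [← Spec.map_comp, ← CommRingCat.ofHom_comp, ← Spec.map_comp, ← CommRingCat.ofHom_comp]
  congr 2
  exact congrArg AlgHom.toRingHom h

theorem restr_comp_ring {σ' τ' : PointedCone ℝ (Fin n → ℝ)} (hσ : σ ≤ σ') (hτ : τ ≤ τ')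
    (h : MapsInto A σ τ) (h' : MapsInto A σ' τ') :
    (restr hσ).comp h'.ring = h.ring.comp (restr hτ) :=
  AddMonoidAlgebra.algHom_ext
    (fun m => by
      rw [AlgHom.comp_apply, AlgHom.comp_apply, h'.ring_single, restr_single, restr_single,
        h.ring_single]
      rfl)
    (Subsingleton.elim _ _)

theorem toTorusRing_comp_ring (h : MapsInto A σ τ) :
    (toTorusRing σ).comp h.ring = (monomialRing A).comp (toTorusRing τ) :=
  AddMonoidAlgebra.algHom_ext
    (fun m => by
      rw [AlgHom.comp_apply, AlgHom.comp_apply, h.ring_single]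
      simp [toTorusRing, monomialRing, MapsInto.dual])
    (Subsingleton.elim _ _)

theorem character_vecMul (t : Fin n → ℂˣ) (m : Fin n → ℤ) :
    character t (Multiplicative.ofAdd (Matrix.vecMul m A)) =
      character (monomialPoint A t) (Multiplicative.ofAdd m) := by
  simp only [character, monomialPoint, MonoidHom.coe_mk, OneHom.coe_mk, toAdd_ofAdd,
    Matrix.vecMul, dotProduct, ← Finset.prod_zpow, ← zpow_mul]
  rw [Finset.prod_comm]
  refine Finset.prod_congr rfl fun j _ => ?_
  simp only [mul_comm (A _ j)]
  induction (Finset.univ : Finset (Fin n)) using Finset.induction_on with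
  | empty => simp
  | insert i s hi ih => rw [Finset.sum_insert hi, Finset.prod_insert hi, zpow_add, ih]

theorem actRing_comp_ring (t : Fin n → ℂˣ) (h : MapsInto A σ τ) :
    (actRing t σ).comp h.ring = h.ring.comp (actRing (monomialPoint A t) τ) :=
  AddMonoidAlgebra.algHom_ext
    (fun m => by
      rw [AlgHom.comp_apply, AlgHom.comp_apply, h.ring_single, actRing_single, actRing_single,
        h.ring_single, ← character_vecMul]
      rfl)
    (Subsingleton.elim _ _)

theorem Fan.hom_ext {Δ : Fan n} {Y : Scheme.{0}} {f g : Δ.variety ⟶ Y}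
    (h : ∀ σ, Δ.chart σ ≫ f = Δ.chart σ ≫ g) : f = g := colimit.hom_ext h

/-- The inclusion `U_σ → U_τ` for `σ ⊆ τ`; it is an open immersion if `σ` is a face of `τ`. -/
noncomputable def incl (h : σ ≤ τ) : affine σ ⟶ affine τ :=
  Spec.map (CommRingCat.ofHom (restr h).toRingHom)

theorem Fan.incl_chart (Δ : Fan n) {σ τ : Δ.Cone} (h : σ.1 ≤ τ.1) :
    incl h ≫ Δ.chart τ = Δ.chart σ :=
  colimit.w Δ.diagram (homOfLE h : σ ⟶ τ)

theorem Fan.chart_toSpec (Δ : Fan n) (σ : Δ.Cone) :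
    Δ.chart σ ≫ Δ.toSpec = Spec.map (CommRingCat.ofHom (algebraMap ℂ (CoordRing σ.1))) :=
  colimit.ι_desc _ _

theorem Fan.chart_act (Δ : Fan n) (t : Fin n → ℂˣ) (σ : Δ.Cone) :
    Δ.chart σ ≫ Δ.act t =
      Spec.map (CommRingCat.ofHom (actRing t σ.1).toRingHom) ≫ Δ.chart σ :=
  ι_colimMap _ _

theorem Fan.inf_mem (Δ : Fan n) (σ τ : Δ.Cone) : σ.1 ⊓ τ.1 ∈ Δ.cones :=
  Δ.face_mem _ σ.2 _ (Δ.inf_isFace σ.1 σ.2 τ.1 τ.2).1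

variable {Δ₁ Δ₂ : Fan n}

/-- The morphisms `U_σ → U_τ → X(Δ₂)` do not depend on the cone `τ` with `A σ ⊆ τ`, and they are
compatible with the inclusions of the charts of `X(Δ₁)`. -/
theorem MapsInto.incl_map_chart {σ σ' : PointedCone ℝ (Fin n → ℝ)} {τ τ' : Δ₂.Cone}
    (hσ : σ ≤ σ') (h : MapsInto A σ τ.1) (h' : MapsInto A σ' τ'.1) :
    incl hσ ≫ h'.map ≫ Δ₂.chart τ' = h.map ≫ Δ₂.chart τ := by
  -- both sides factor through the chart of `τ ∩ τ'`
  let ρ : Δ₂.Cone := ⟨τ.1 ⊓ τ'.1, Δ₂.inf_mem τ τ'⟩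
  have hρ : MapsInto A σ ρ.1 := fun x hx => ⟨h x hx, h' x (hσ hx)⟩
  have hρτ : ρ.1 ≤ τ.1 := inf_le_left
  have hρτ' : ρ.1 ≤ τ'.1 := inf_le_right
  have e1 : incl hσ ≫ h'.map = hρ.map ≫ incl hρτ' :=
    specMap_comp_eq (restr_comp_ring hσ hρτ' hρ h')
  have e2 : hρ.map ≫ incl hρτ = h.map := by
    refine Eq.trans (specMap_comp_eq (restr_comp_ring le_rfl hρτ hρ h)).symm ?_
    rw [restr_refl]
    exact (congrArg (· ≫ h.map) (Spec.map_id _)).trans (Category.id_comp _)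
  rw [← Category.assoc, e1, ← e2, Category.assoc, Category.assoc, Δ₂.incl_chart, Δ₂.incl_chart]

/-- The linear map with matrix `A` maps each cone of `Δ₁` into a cone of `Δ₂`. -/
def IsFanMap (A : Matrix (Fin n) (Fin n) ℤ) (Δ₁ Δ₂ : Fan n) : Prop :=
  ∀ σ : Δ₁.Cone, ∃ τ : Δ₂.Cone, MapsInto A σ.1 τ.1

/-- The toric morphism `X(Δ₁) → X(Δ₂)` that extends the monomial map `f_A`. -/
noncomputable def IsFanMap.map (H : IsFanMap A Δ₁ Δ₂) : Δ₁.variety ⟶ Δ₂.variety :=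
  colimit.desc Δ₁.diagram
    { pt := Δ₂.variety
      ι :=
        { app := fun σ => (H σ).choose_spec.map ≫ Δ₂.chart (H σ).choose
          naturality := fun _ _ f =>
            (MapsInto.incl_map_chart (leOfHom f) _ _).trans (Category.comp_id _).symm } }

theorem IsFanMap.chart_map (H : IsFanMap A Δ₁ Δ₂) {σ : Δ₁.Cone} {τ : Δ₂.Cone}
    (h : MapsInto A σ.1 τ.1) : Δ₁.chart σ ≫ H.map = h.map ≫ Δ₂.chart τ := by
  have e : Δ₁.chart σ ≫ H.map = (H σ).choose_spec.map ≫ Δ₂.chart (H σ).choose :=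
    colimit.ι_desc _ _
  rw [e, ← MapsInto.incl_map_chart le_rfl (H σ).choose_spec h, incl, restr_refl]
  exact (congrArg (· ≫ h.map ≫ Δ₂.chart τ) (Spec.map_id _)).trans (Category.id_comp _)

theorem IsFanMap.map_toSpec (H : IsFanMap A Δ₁ Δ₂) : H.map ≫ Δ₂.toSpec = Δ₁.toSpec := by
  refine Fan.hom_ext fun σ => ?_
  obtain ⟨τ, h⟩ := H σ
  rw [← Category.assoc, H.chart_map h, Category.assoc, Δ₂.chart_toSpec, Δ₁.chart_toSpec]
  change Spec.map _ ≫ Spec.map _ = Spec.map _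
  rw [← Spec.map_comp, ← CommRingCat.ofHom_comp]
  congr 2
  exact h.ring.comp_algebraMap

theorem IsFanMap.torusι_map (H : IsFanMap A Δ₁ Δ₂) :
    Δ₁.torusι ≫ H.map = monomialTorus A ≫ Δ₂.torusι := by
  obtain ⟨τ, h⟩ := H Δ₁.zeroCone
  rw [Δ₁.torusι_eq Δ₁.zeroCone, Δ₂.torusι_eq τ, Category.assoc, H.chart_map h,
    ← Category.assoc, ← Category.assoc]
  congr 1
  exact specMap_comp_eq (toTorusRing_comp_ring h)

theorem IsFanMap.isEquivariant (H : IsFanMap A Δ₁ Δ₂) : IsEquivariant A H.map := by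
  intro t
  refine Fan.hom_ext fun σ => ?_
  obtain ⟨τ, h⟩ := H σ
  rw [← Category.assoc, Δ₁.chart_act, ← Category.assoc, H.chart_map h, Category.assoc,
    H.chart_map h, Category.assoc, Δ₂.chart_act, ← Category.assoc, ← Category.assoc]
  congr 1
  exact specMap_comp_eq (actRing_comp_ring t h)

theorem monomialTorus_one : monomialTorus (1 : Matrix (Fin n) (Fin n) ℤ) = 𝟙 (torus n) := by
  have : monomialRing (1 : Matrix (Fin n) (Fin n) ℤ) = AlgHom.id ℂ _ :=
    AddMonoidAlgebra.algHom_ext (fun m => by simp [monomialRing]) (Subsingleton.elim _ _)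
  rw [monomialTorus, this]
  exact Spec.map_id _

/-! ### Rational maps -/

section RationalMap

open Scheme

instance isDominant_toRationalMap {X Y : Scheme.{0}} [PreirreducibleSpace X] [Nonempty Y]
    (f : X ⟶ Y) [IsDominant f] : f.toRationalMap.IsDominant := by
  have : IsDominant f.toPartialMap.hom :=
    inferInstanceAs (IsDominant (X.topIso.hom ≫ f))
  infer_instance

theorem partialIso_iso {U X : Scheme.{0}} (f : U ⟶ X) [IsOpenImmersion f]
    [IsDominant f] : f.partialIso.iso = U.topIso ≪≫ f.isoOpensRange := by
  apply Iso.ext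
  change (U.topIso.hom ≫ f.isoOpensRange.hom ≫ f.opensRange.toScheme.topIso.inv) ≫
    (Scheme.isoOfEq _ rfl).hom ≫ f.opensRange.toScheme.topIso.hom =
      U.topIso.hom ≫ f.isoOpensRange.hom
  simp

theorem partialIso_toRationalMap {U X : Scheme.{0}} (f : U ⟶ X) [IsOpenImmersion f]
    [IsDominant f] : f.partialIso.toRationalMap = f.toRationalMap := by
  have : f.partialIso.toPartialMap = f.toPartialMap := by
    refine PartialMap.ext _ _ rfl ?_
    refine Eq.trans (congrArg (fun e : (⊤ : U.Opens).toScheme ≅ f.opensRange.toScheme =>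
      e.hom ≫ f.opensRange.ι) (partialIso_iso f)) ?_
    change _ = (Scheme.isoOfEq _ rfl).hom ≫ U.topIso.hom ≫ f
    simp
  rw [PartialIso.toRationalMap, this]

theorem toRationalMap_comp_symm {X Y : Scheme.{0}} [IrreducibleSpace X]
    [IrreducibleSpace Y] (e : X.PartialIso Y) :
    e.toRationalMap.comp e.symm.toRationalMap = RationalMap.id X := by
  have : IsDominant e.target.ι := Opens.isDominant_ι e.dense_target
  have : IsDominant e.toPartialMap.hom :=
    inferInstanceAs (IsDominant (e.iso.hom ≫ e.target.ι))
  -- the composite of the representatives is the inclusion of its domain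
  have key : (e.iso.hom ≫ e.target.ι) ∣_ e.target ≫ e.iso.inv ≫ e.source.ι =
      ((e.iso.hom ≫ e.target.ι) ⁻¹ᵁ e.target).ι ≫ e.source.ι := by
    have : (e.iso.hom ≫ e.target.ι) ∣_ e.target =
        ((e.iso.hom ≫ e.target.ι) ⁻¹ᵁ e.target).ι ≫ e.iso.hom := by
      rw [← cancel_mono e.target.ι, morphismRestrict_ι, Category.assoc]
    rw [this, Category.assoc, e.iso.hom_inv_id_assoc]
  rw [RationalMap.toRationalMap_comp, PartialMap.toRationalMap_eq_iff]
  refine ⟨_, (e.toPartialMap.comp e.symm.toPartialMap).dense_domain, le_rfl, le_top, ?_⟩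
  have h : (e.toPartialMap.comp e.symm.toPartialMap).hom =
      (e.toPartialMap.comp e.symm.toPartialMap).domain.ι := by
    refine Eq.trans (congrArg ((e.source.ι.isoImage _).inv ≫ ·) key) ?_
    exact (Opens.isoImage_ι_inv_ι_assoc _ _ _).trans (X.homOfLE_ι _)
  change X.homOfLE _ ≫ (e.toPartialMap.comp e.symm.toPartialMap).hom =
    X.homOfLE _ ≫ X.topIso.hom ≫ 𝟙 X
  rw [h]
  simp

/-- The partial isomorphism between two schemes with a common dense open subscheme. -/
noncomputable def partialIsoOfDominant {U X X' : Scheme.{0}} (J' : U ⟶ X') (J : U ⟶ X)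
    [IsOpenImmersion J] [IsDominant J] [IsOpenImmersion J'] [IsDominant J'] : X'.PartialIso X where
  source := J'.opensRange
  dense_source := J'.denseRange
  target := J.opensRange
  dense_target := J.denseRange
  iso := J'.isoOpensRange.symm ≪≫ J.isoOpensRange

theorem partialIsoOfDominant_toRationalMap {U X X' : Scheme.{0}} (J' : U ⟶ X') (J : U ⟶ X)
    [IsOpenImmersion J] [IsDominant J] [IsOpenImmersion J'] [IsDominant J'] :
    (partialIsoOfDominant J' J).toRationalMap = J'.partialIso.symm.toRationalMap.compHom J := by
  have : (partialIsoOfDominant J' J).toPartialMap = J'.partialIso.symm.toPartialMap.compHom J := by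
    refine PartialMap.ext _ _ rfl ?_
    change (J'.isoOpensRange.inv ≫ J.isoOpensRange.hom) ≫ J.opensRange.ι =
      (Scheme.isoOfEq _ rfl).hom ≫ (J'.partialIso.iso.inv ≫ (⊤ : U.Opens).ι) ≫ J
    refine Eq.trans ?_ (congrArg (fun e : (⊤ : U.Opens).toScheme ≅ J'.opensRange.toScheme =>
      (Scheme.isoOfEq _ rfl).hom ≫ (e.inv ≫ (⊤ : U.Opens).ι) ≫ J) (partialIso_iso J')).symm
    simp
  rw [PartialIso.toRationalMap, this, RationalMap.compHom_toRationalMap]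

theorem partialIso_symm_compHom {U X : Scheme.{0}} [IrreducibleSpace X] [IrreducibleSpace U]
    (f : U ⟶ X) [IsOpenImmersion f] [IsDominant f] :
    f.partialIso.symm.toRationalMap.compHom f = RationalMap.id X := by
  rw [← RationalMap.comp_toRationalMap, ← partialIso_toRationalMap]
  exact toRationalMap_comp_symm f.partialIso.symm

theorem compHom_compHom {X Y Z W : Scheme.{0}} (k : X ⤏ Y) (f : Y ⟶ Z) (g : Z ⟶ W) :
    (k.compHom f).compHom g = k.compHom (f ≫ g) := by
  obtain ⟨k, rfl⟩ := k.exists_rep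
  have : (k.compHom f).compHom g = k.compHom (f ≫ g) := by
    refine PartialMap.ext _ _ rfl ?_
    change (k.hom ≫ f) ≫ g = (Scheme.isoOfEq _ rfl).hom ≫ k.hom ≫ f ≫ g
    simp
  rw [← RationalMap.compHom_toRationalMap, ← RationalMap.compHom_toRationalMap, this,
    RationalMap.compHom_toRationalMap]

theorem partialIso_symm_compHom_comp {U X Y : Scheme.{0}} [IrreducibleSpace X]
    [IrreducibleSpace U] (f : U ⟶ X) [IsOpenImmersion f] [IsDominant f] (g : X ⟶ Y) :
    f.partialIso.symm.toRationalMap.compHom (f ≫ g) = g.toRationalMap := by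
  rw [← compHom_compHom, partialIso_symm_compHom, RationalMap.id_compHom]

theorem comp_symm_compHom {U X Y Z : Scheme.{0}} [IrreducibleSpace X] [IrreducibleSpace U]
    [IrreducibleSpace Y] [Nonempty Z] (f : U ⟶ X) [IsOpenImmersion f] [IsDominant f]
    {F : Y ⤏ X} [F.IsDominant] {k : Y ⤏ U} [k.IsDominant] (hF : F = k.compHom f) (g : U ⟶ Z) :
    F.comp (f.partialIso.symm.toRationalMap.compHom g) = k.compHom g := by
  have h : f.toRationalMap.comp (f.partialIso.symm.toRationalMap.compHom g) =
      g.toRationalMap := by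
    have := toRationalMap_comp_symm f.partialIso
    simp only [partialIso_toRationalMap] at this
    rw [← RationalMap.comp_toRationalMap, ← RationalMap.comp_assoc, RationalMap.comp_toRationalMap,
      this, RationalMap.id_compHom]
  rw [← RationalMap.comp_toRationalMap] at hF
  subst hF
  rw [RationalMap.comp_assoc, h, RationalMap.comp_toRationalMap]

/-- Conjugation by the partial isomorphism given by a common dense open subscheme `U`: the
conjugate of the rational map which is `φ` on `U` is the rational map of any morphism which is `φ`
on `U`. -/
theorem conj_partialIsoOfDominant {U X X' : Scheme.{0}} [IrreducibleSpace U]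
    [IrreducibleSpace X] [IrreducibleSpace X'] (J' : U ⟶ X') (J : U ⟶ X) [IsOpenImmersion J]
    [IsDominant J] [IsOpenImmersion J'] [IsDominant J'] (φ : U ⟶ U) [IsDominant φ] {F : X ⤏ X}
    [F.IsDominant] (hF : F = J.partialIso.symm.toRationalMap.compHom (φ ≫ J)) {g : X' ⟶ X'}
    (hg : J' ≫ g = φ ≫ J') [(partialIsoOfDominant J' J).toRationalMap.IsDominant]
    [((partialIsoOfDominant J' J).toRationalMap.comp F).IsDominant] :
    ((partialIsoOfDominant J' J).toRationalMap.comp F).comp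
      (partialIsoOfDominant J' J).symm.toRationalMap = g.toRationalMap := by
  have e1 : (partialIsoOfDominant J' J).symm.toRationalMap =
      J.partialIso.symm.toRationalMap.compHom J' := partialIsoOfDominant_toRationalMap J J'
  have e2 := comp_symm_compHom J (partialIsoOfDominant_toRationalMap J' J) (φ ≫ J)
  rw [← hF, ← compHom_compHom] at e2
  have : (J'.partialIso.symm.toRationalMap.compHom φ).IsDominant := by
    rw [← RationalMap.comp_toRationalMap]
    infer_instance
  rw [e1, comp_symm_compHom J e2, compHom_compHom, ← hg, partialIso_symm_compHom_comp]

end RationalMap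

/-! ### Morphisms from affine schemes to `Proj` -/

section Proj

open HomogeneousLocalization

variable {A S : Type} [CommRing A] [SetLike S A] [AddSubgroupClass S A] (𝒜 : ℕ → S)
  [GradedRing 𝒜] {R : Type} [CommRing R]

/-- The homomorphism `A_(f) → R`, `a / f^k ↦ φ(a) / φ(f)^k`, for a homomorphism `φ : A → R` such
that `φ(f)` is invertible. -/
noncomputable def awayEval (φ : A →+* R) {f : A} (hf : IsUnit (φ f)) : Away 𝒜 f →+* R :=
  (Localization.awayLift φ f hf).comp (algebraMap (Away 𝒜 f) (Localization.Away f))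

theorem awayEval_mk (φ : A →+* R) {f : A} (hf : IsUnit (φ f)) {d : ℕ} (hd : f ∈ 𝒜 d) (k : ℕ)
    (a : A) (ha : a ∈ 𝒜 (k • d)) :
    awayEval 𝒜 φ hf (Away.mk 𝒜 hd k a ha) * φ f ^ k = φ a := by
  obtain ⟨v, hv⟩ := isUnit_iff_exists_inv.1 hf
  change Localization.awayLift φ f hf (Localization.mk a ⟨f ^ k, _⟩) * _ = _
  rw [Localization.awayLift_mk φ f a v hv, mul_assoc, ← mul_pow, mul_comm v, hv, one_pow, mul_one]

theorem awayEval_fromZeroRingHom (φ : A →+* R) {f : A} (hf : IsUnit (φ f)) (a : 𝒜 0) :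
    awayEval 𝒜 φ hf (fromZeroRingHom 𝒜 _ a) = φ a :=
  IsLocalization.Away.lift_eq f hf (a : A)

theorem awayEval_ext {φ : A →+* R} {f : A} {hφ : IsUnit (φ f)} {g : Away 𝒜 f →+* R} {d : ℕ}
    (hd : f ∈ 𝒜 d)
    (h : ∀ k a ha, g (Away.mk 𝒜 hd k a ha) * φ f ^ k = φ a) : g = awayEval 𝒜 φ hφ := by
  refine RingHom.ext fun x => ?_
  obtain ⟨k, a, ha, rfl⟩ := Away.mk_surjective 𝒜 hd x
  exact (hφ.pow k).mul_left_injective ((h k a ha).trans (awayEval_mk 𝒜 φ hφ hd k a ha).symm)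

theorem awayEval_comp_awayMap (φ : A →+* R) {f g : A} (hf : IsUnit (φ f)) (hfg : IsUnit (φ (f * g)))
    {d e : ℕ} (hd : f ∈ 𝒜 d) (he : g ∈ 𝒜 e) :
    (awayEval 𝒜 φ hfg).comp (awayMap 𝒜 he rfl) = awayEval 𝒜 φ hf := by
  refine awayEval_ext 𝒜 hd fun k a ha => ?_
  have hg : IsUnit (φ g) := isUnit_of_mul_isUnit_right (by rwa [map_mul] at hfg)
  refine (hg.pow k).mul_left_injective ?_
  dsimp only
  rw [mul_assoc, ← mul_pow, ← map_mul, RingHom.comp_apply, awayMap_mk, awayEval_mk, map_mul,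
    map_pow]

/-- Homomorphisms that differ by the powers of a unit agree on homogeneous fractions. -/
theorem awayEval_eq_of_twist {φ ψ : A →+* R} {f : A} (hφ : IsUnit (φ f)) (hψ : IsUnit (ψ f))
    {d : ℕ} (hd : f ∈ 𝒜 d) {u : R} (hu : IsUnit u) (h : ∀ k, ∀ a ∈ 𝒜 k, ψ a = u ^ k * φ a) :
    awayEval 𝒜 ψ hψ = awayEval 𝒜 φ hφ := by
  refine awayEval_ext 𝒜 hd fun k a ha => ?_
  have := awayEval_mk 𝒜 ψ hψ hd k a ha
  rw [h _ a ha, h _ f hd, mul_pow, ← pow_mul, mul_left_comm, smul_eq_mul, mul_comm k d] at this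
  exact (hu.pow (d * k)).mul_right_injective this

/-- The morphism `Spec R → D₊(f) ⊆ Proj A` given by `awayEval`. -/
noncomputable def toProj (φ : A →+* R) {f : A} (hf : IsUnit (φ f)) {d : ℕ} (hd : f ∈ 𝒜 d)
    (h0 : 0 < d) : Spec (CommRingCat.of R) ⟶ Proj 𝒜 :=
  Spec.map (CommRingCat.ofHom (awayEval 𝒜 φ hf)) ≫ Proj.awayι 𝒜 f hd h0

theorem toProj_mul (φ : A →+* R) {f g x : A} (hf : IsUnit (φ f)) (hx : IsUnit (φ x)) {d e c : ℕ}
    (hd : f ∈ 𝒜 d) (h0 : 0 < d) (he : g ∈ 𝒜 e) (hc : x ∈ 𝒜 c) (h0c : 0 < c) (hfg : x = f * g)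
    (hde : c = d + e) : toProj 𝒜 φ hf hd h0 = toProj 𝒜 φ hx hc h0c := by
  subst hfg hde
  rw [toProj, toProj, ← awayEval_comp_awayMap 𝒜 φ hf hx hd he, CommRingCat.ofHom_comp,
    Spec.map_comp, Category.assoc, Proj.SpecMap_awayMap_awayι]

/-- The morphism `toProj` does not depend on the homogeneous element `f` with `φ(f)`
invertible. -/
theorem toProj_eq (φ : A →+* R) {f g : A} (hf : IsUnit (φ f)) (hg : IsUnit (φ g)) {d e : ℕ}
    (hd : f ∈ 𝒜 d) (h0 : 0 < d) (he : g ∈ 𝒜 e) (h0e : 0 < e) :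
    toProj 𝒜 φ hf hd h0 = toProj 𝒜 φ hg he h0e := by
  have hx : IsUnit (φ (f * g)) := by rw [map_mul]; exact hf.mul hg
  have hc : f * g ∈ 𝒜 (d + e) := SetLike.mul_mem_graded hd he
  exact (toProj_mul 𝒜 φ hf hx hd h0 he hc (by omega) rfl rfl).trans
    (toProj_mul 𝒜 φ hg hx he h0e hd hc (by omega) (mul_comm _ _) (add_comm _ _)).symm

theorem toProj_comp {R' : Type} [CommRing R'] (ψ : R →+* R') (φ : A →+* R) {f : A}
    (hf : IsUnit (φ f)) {d : ℕ} (hd : f ∈ 𝒜 d) (h0 : 0 < d) :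
    Spec.map (CommRingCat.ofHom ψ) ≫ toProj 𝒜 φ hf hd h0 =
      toProj 𝒜 (ψ.comp φ) (hf.map ψ) hd h0 := by
  have : ψ.comp (awayEval 𝒜 φ hf) = awayEval 𝒜 (ψ.comp φ) (hf.map ψ) := by
    refine awayEval_ext 𝒜 (φ := ψ.comp φ) hd fun k a ha => ?_
    rw [RingHom.comp_apply, RingHom.comp_apply, ← map_pow, ← map_mul, awayEval_mk]
    rfl
  rw [toProj, toProj, ← Category.assoc, ← Spec.map_comp, ← CommRingCat.ofHom_comp, this]

theorem toProj_mem_basicOpen (φ : A →+* R) {f g : A} (hf : IsUnit (φ f)) {d e : ℕ} (hd : f ∈ 𝒜 d)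
    (h0 : 0 < d) (he : g ∈ 𝒜 e) (h0e : 0 < e) (p : Spec (CommRingCat.of R)) :
    toProj 𝒜 φ hf hd h0 p ∈ Proj.basicOpen 𝒜 g ↔ p ∈ PrimeSpectrum.basicOpen (φ g) := by
  have h1 : toProj 𝒜 φ hf hd h0 p ∈ Proj.basicOpen 𝒜 g ↔
      Spec.map (CommRingCat.ofHom (awayEval 𝒜 φ hf)) p ∈
        Proj.awayι 𝒜 f hd h0 ⁻¹ᵁ Proj.basicOpen 𝒜 g := Iff.rfl
  rw [h1, Proj.awayι_preimage_basicOpen 𝒜 hd h0 he h0e]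
  have h2 : awayEval 𝒜 φ hf (Away.isLocalizationElem hd he) * φ f ^ e = φ g ^ d := by
    rw [awayEval_mk, map_pow]
  have h3 : p ∈ PrimeSpectrum.basicOpen (φ g) ↔ p ∈ PrimeSpectrum.basicOpen (φ g ^ d) := by
    rw [PrimeSpectrum.basicOpen_pow _ d h0]
  have h4 : PrimeSpectrum.basicOpen (φ f) = ⊤ :=
    top_le_iff.1 fun q _ hq => q.2.ne_top (Ideal.eq_top_of_isUnit_mem _ hq hf)
  rw [h3, ← h2, PrimeSpectrum.basicOpen_mul, PrimeSpectrum.basicOpen_pow _ e h0e,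
    h4, inf_top_eq]
  rfl

/-- If the preimage of `D₊(f)` is an affine open `Spec R`, on which the morphism is given by
`A_(f) → R`, then over `D₊(f)` the morphism is a closed immersion as soon as `A_(f) → R` is
surjective. -/
theorem isClosedImmersion_morphismRestrict {X : Scheme.{0}} (Φ : X ⟶ Proj 𝒜)
    (j : Spec (CommRingCat.of R) ⟶ X) [IsOpenImmersion j] (φ : A →+* R) {f : A}
    (hf : IsUnit (φ f)) {d : ℕ} (hd : f ∈ 𝒜 d) (h0 : 0 < d) (hj : j ≫ Φ = toProj 𝒜 φ hf hd h0)
    (hpre : Φ ⁻¹ᵁ Proj.basicOpen 𝒜 f = j.opensRange)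
    (hsurj : Function.Surjective (awayEval 𝒜 φ hf)) :
    IsClosedImmersion (Φ ∣_ Proj.basicOpen 𝒜 f) := by
  have hr : (Proj.awayι 𝒜 f hd h0).opensRange = Proj.basicOpen 𝒜 f :=
    Proj.opensRange_awayι 𝒜 f hd h0
  have hpb : IsPullback (Spec.map (CommRingCat.ofHom (awayEval 𝒜 φ hf))) j
      (Proj.awayι 𝒜 f hd h0) Φ :=
    IsOpenImmersion.isPullback _ _ _ _ hj (by rw [hr, hpre])
  have hc : IsClosedImmersion (Spec.map (CommRingCat.ofHom (awayEval 𝒜 φ hf))) :=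
    IsClosedImmersion.spec_of_surjective _ hsurj
  rw [← hr]
  refine (MorphismProperty.arrow_mk_iso_iff @IsClosedImmersion
    (morphismRestrictOpensRange Φ (Proj.awayι 𝒜 f hd h0))).2 ?_
  rw [← hpb.flip.isoPullback_inv_snd]
  infer_instance

end Proj

/-! ### A criterion for projectivity -/

/-- Lattice points `b₀, …, bₘ` that define a closed embedding of `X(Δ)` in `ℙᵐ`: for each cone `σ`,
the elements of `σ`, as functionals on `M`, attain their minimum over the `bᵢ` at the point with
index `v σ`, and the differences to this point generate `S_σ`; the points `b_(v τ)` separate the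
cones; the rational convex hull of the points `b_(v τ)` contains all `bᵢ`, which is expressed by
saying that a positive multiple `N bᵢ` is the sum of `N` of the points `b_(v τ)`. -/
structure ProjectiveEmbedding (Δ : Fan n) (m : ℕ) where
  b : Fin (m + 1) → Fin n → ℤ
  v : Δ.Cone → Fin (m + 1)
  sub_mem : ∀ σ i, b i - b (v σ) ∈ dualMonoid σ.1
  generate : ∀ σ, dualMonoid σ.1 ≤ AddSubmonoid.closure (Set.range fun i => b i - b (v σ))
  separate : ∀ (σ τ : Δ.Cone), ∀ x ∈ σ.1, toReal (b (v τ) - b (v σ)) ⬝ᵥ x = 0 → x ∈ τ.1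
  convex : ∀ i, ∃ w : Multiset Δ.Cone, w ≠ 0 ∧ w.card • b i = (w.map fun τ => b (v τ)).sum

namespace ProjectiveEmbedding

open MvPolynomial

variable {Δ : Fan n} {m : ℕ} (P : ProjectiveEmbedding Δ m)

attribute [local instance] MvPolynomial.gradedAlgebra

/-- The function `xᵢ / x_(v σ) = χ^(bᵢ - b_(v σ))` on `U_σ`. -/
noncomputable def coord (σ : Δ.Cone) (i : Fin (m + 1)) : CoordRing σ.1 :=
  AddMonoidAlgebra.single (⟨P.b i - P.b (P.v σ), P.sub_mem σ i⟩ : dualMonoid σ.1) (1 : ℂ)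

/-- The homomorphism `ℂ[x₀, …, xₘ] → ℂ[S_σ]` given by the functions `xᵢ / x_(v σ)`. -/
noncomputable def eval (σ : Δ.Cone) : MvPolynomial (Fin (m + 1)) ℂ →ₐ[ℂ] CoordRing σ.1 :=
  aeval (P.coord σ)

theorem eval_X (σ : Δ.Cone) (i : Fin (m + 1)) : P.eval σ (X i) = P.coord σ i := aeval_X _ _

theorem coord_v (σ : Δ.Cone) : P.coord σ (P.v σ) = 1 := by
  rw [coord, AddMonoidAlgebra.one_def]
  congr 1
  exact Subtype.ext (sub_self _)

theorem isUnit_eval (σ : Δ.Cone) :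
    IsUnit ((P.eval σ : MvPolynomial (Fin (m + 1)) ℂ →+* CoordRing σ.1) (X (P.v σ))) := by
  change IsUnit (P.eval σ _)
  rw [eval_X, coord_v]
  exact isUnit_one

theorem X_mem (i : Fin (m + 1)) : (X i : MvPolynomial (Fin (m + 1)) ℂ) ∈
    homogeneousSubmodule (Fin (m + 1)) ℂ 1 := isHomogeneous_X ℂ i

theorem aeval_mul_of_isHomogeneous {R : Type} [CommRing R] [Algebra ℂ R] (x : Fin (m + 1) → R)
    (u : R) {k : ℕ} {p : MvPolynomial (Fin (m + 1)) ℂ} (hp : p.IsHomogeneous k) :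
    aeval (fun i => u * x i) p = u ^ k * aeval x p := by
  rw [aeval_def, aeval_def, eval₂_eq', eval₂_eq', Finset.mul_sum]
  refine Finset.sum_congr rfl fun d hd => ?_
  have hk : ∑ i, d i = k := by
    have := hp.degree_eq_sum_deg_support hd
    rw [this, ← Finsupp.degree_apply, Finsupp.degree_eq_sum]
  rw [← hk, ← Finset.prod_pow_eq_pow_sum]
  simp only [mul_pow, Finset.prod_mul_distrib]
  ring

/-- The morphism `U_σ → D₊(x_(v σ)) ⊆ ℙᵐ` with coordinates `χ^(bᵢ - b_(v σ))`. -/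
noncomputable def chartMap (σ : Δ.Cone) : affine σ.1 ⟶ projectiveSpace m :=
  toProj (homogeneousSubmodule (Fin (m + 1)) ℂ)
    (P.eval σ : MvPolynomial (Fin (m + 1)) ℂ →+* CoordRing σ.1) (P.isUnit_eval σ)
    (X_mem (P.v σ)) one_pos

theorem incl_chartMap {τ σ : Δ.Cone} (h : τ.1 ≤ σ.1) :
    incl h ≫ P.chartMap σ = P.chartMap τ := by
  -- the two sets of coordinates differ by the unit `χ^(b_(v τ) - b_(v σ))`
  let u : CoordRing τ.1 := AddMonoidAlgebra.single
    (⟨P.b (P.v τ) - P.b (P.v σ), dualMonoid_anti h (P.sub_mem σ _)⟩ : dualMonoid τ.1) (1 : ℂ)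
  have hu : IsUnit u := by
    refine IsUnit.of_mul_eq_one (P.coord τ (P.v σ)) ?_
    rw [coord, AddMonoidAlgebra.single_mul_single, AddMonoidAlgebra.one_def, mul_one]
    congr 1
    exact Subtype.ext (sub_add_sub_cancel' _ _ _ |>.trans (sub_self _))
  have hcoord : ∀ i, restr h (P.coord σ i) = u * P.coord τ i := fun i => by
    rw [coord, restr_single, coord, AddMonoidAlgebra.single_mul_single, mul_one]
    congr 1
    exact Subtype.ext (sub_add_sub_cancel' _ _ _).symm
  have heval : (restr h).comp (P.eval σ) = aeval fun i => u * P.coord τ i := by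
    refine MvPolynomial.algHom_ext fun i => ?_
    rw [AlgHom.comp_apply, eval_X, hcoord, aeval_X]
  let ψ : MvPolynomial (Fin (m + 1)) ℂ →+* CoordRing τ.1 :=
    (restr h).toRingHom.comp (P.eval σ : MvPolynomial (Fin (m + 1)) ℂ →+* CoordRing σ.1)
  have hψ : ∀ p, ψ p = aeval (fun i => u * P.coord τ i) p := fun p => DFunLike.congr_fun heval p
  have hX : IsUnit (ψ (X (P.v τ))) := by
    rw [hψ, aeval_X, coord_v, mul_one]
    exact hu
  have e1 := toProj_comp (homogeneousSubmodule (Fin (m + 1)) ℂ) (restr h).toRingHom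
    (P.eval σ : MvPolynomial (Fin (m + 1)) ℂ →+* CoordRing σ.1) (P.isUnit_eval σ)
    (X_mem (P.v σ)) one_pos
  refine e1.trans ((toProj_eq (homogeneousSubmodule (Fin (m + 1)) ℂ) ψ _ hX _ _
    (X_mem (P.v τ)) one_pos).trans ?_)
  rw [chartMap, toProj, toProj, awayEval_eq_of_twist (homogeneousSubmodule (Fin (m + 1)) ℂ)
    (P.isUnit_eval τ) hX (X_mem (P.v τ)) hu fun k a ha =>
      (hψ a).trans (aeval_mul_of_isHomogeneous (P.coord τ) u ha)]

/-- The morphism `X(Δ) → ℙᵐ` whose homogeneous coordinates are the characters `χ^(bᵢ)`. -/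
noncomputable def toProjectiveSpace : Δ.variety ⟶ projectiveSpace m :=
  colimit.desc Δ.diagram
    { pt := projectiveSpace m
      ι :=
        { app := fun σ => P.chartMap σ
          naturality := fun _ _ f =>
            (P.incl_chartMap (leOfHom f)).trans (Category.comp_id _).symm } }

theorem chart_toProjectiveSpace (σ : Δ.Cone) :
    Δ.chart σ ≫ P.toProjectiveSpace = P.chartMap σ :=
  colimit.ι_desc _ _

theorem toProjectiveSpace_toSpec :
    P.toProjectiveSpace ≫ projectiveSpaceToSpec m = Δ.toSpec := by
  refine Fan.hom_ext fun σ => ?_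
  rw [← Category.assoc, chart_toProjectiveSpace, Δ.chart_toSpec]
  change (Spec.map _ ≫ Proj.awayι _ _ _ _) ≫ Proj.toSpecZero _ ≫ Spec.map _ = _
  rw [Category.assoc, Proj.awayι_toSpecZero_assoc, ← Spec.map_comp, ← Spec.map_comp,
    ← CommRingCat.ofHom_comp, ← CommRingCat.ofHom_comp]
  congr 2
  refine RingHom.ext fun c => ?_
  exact (awayEval_fromZeroRingHom _ _ (P.isUnit_eval σ) _).trans ((P.eval σ).commutes c)

theorem mem_preimage_basicOpen {σ : Δ.Cone} {p : MvPolynomial (Fin (m + 1)) ℂ} {k : ℕ}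
    (hp : p.IsHomogeneous k) (hk : 0 < k) (y : affine σ.1) :
    Δ.chart σ y ∈ P.toProjectiveSpace ⁻¹ᵁ
      Proj.basicOpen (homogeneousSubmodule (Fin (m + 1)) ℂ) p ↔
        y ∈ PrimeSpectrum.basicOpen (P.eval σ p) := by
  have h : P.toProjectiveSpace (Δ.chart σ y) = P.chartMap σ y := by
    rw [← P.chart_toProjectiveSpace]; rfl
  change P.toProjectiveSpace (Δ.chart σ y) ∈
    Proj.basicOpen (homogeneousSubmodule (Fin (m + 1)) ℂ) p ↔ _
  rw [h]
  exact toProj_mem_basicOpen _ _ _ _ _ hp hk y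

/-- The preimage of `D₊(x_(v σ))` is the chart `U_σ`. -/
theorem preimage_basicOpen_X (σ : Δ.Cone) :
    P.toProjectiveSpace ⁻¹ᵁ
      Proj.basicOpen (homogeneousSubmodule (Fin (m + 1)) ℂ) (X (P.v σ)) =
        (Δ.chart σ).opensRange := by
  refine le_antisymm (fun x hx => ?_) ?_
  · obtain ⟨τ, y, rfl⟩ := Scheme.IsLocallyDirected.ι_jointly_surjective Δ.diagram x
    have hy := (P.mem_preimage_basicOpen (X_mem _) one_pos y).1 hx
    rw [eval_X] at hy
    let ρ : Δ.Cone := ⟨τ.1 ⊓ σ.1, Δ.inf_mem τ σ⟩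
    have hρτ : ρ.1 ≤ τ.1 := inf_le_left
    have hρσ : ρ.1 ≤ σ.1 := inf_le_right
    have hcut : ∀ z, z ∈ ρ.1 ↔
        z ∈ τ.1 ∧ toReal (P.b (P.v σ) - P.b (P.v τ)) ⬝ᵥ z = 0 := fun z => by
      refine ⟨fun hz => ⟨hz.1, le_antisymm ?_ (P.sub_mem τ _ z hz.1)⟩,
        fun hz => ⟨hz.1, P.separate τ σ z hz.1 hz.2⟩⟩
      have h1 := P.sub_mem σ (P.v τ) z hz.2
      have e : toReal (P.b (P.v τ) - P.b (P.v σ)) = -toReal (P.b (P.v σ) - P.b (P.v τ)) := by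
        ext i; simp [toReal]
      rw [e, neg_dotProduct] at h1
      linarith
    let := (restr hρτ).toRingHom.toAlgebra
    have := isLocalization_restr (Δ.rational _ τ.2) hρτ (P.sub_mem τ (P.v σ)) hcut
    have hr : Set.range (incl hρτ) =
        (PrimeSpectrum.basicOpen (P.coord τ (P.v σ)) : Set (PrimeSpectrum (CoordRing τ.1))) :=
      PrimeSpectrum.localization_away_comap_range (CoordRing ρ.1)
        (AddMonoidAlgebra.single (⟨_, P.sub_mem τ (P.v σ)⟩ : dualMonoid τ.1) (1 : ℂ))
    obtain ⟨z, rfl⟩ : y ∈ Set.range (incl hρτ) := hr ▸ hy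
    refine ⟨incl hρσ z, ?_⟩
    have e1 : incl hρσ ≫ Δ.chart σ = incl hρτ ≫ Δ.chart τ :=
      (Δ.incl_chart (σ := ρ) (τ := σ) hρσ).trans (Δ.incl_chart (σ := ρ) (τ := τ) hρτ).symm
    exact congrArg (fun f : affine ρ.1 ⟶ Δ.variety => f z) e1
  · rintro _ ⟨z, rfl⟩
    refine (P.mem_preimage_basicOpen (X_mem _) one_pos z).2 ?_
    rw [eval_X, coord_v, PrimeSpectrum.basicOpen_one]
    trivial

theorem surjective_awayEval (σ : Δ.Cone) :
    Function.Surjective (awayEval (homogeneousSubmodule (Fin (m + 1)) ℂ)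
      (P.eval σ : MvPolynomial (Fin (m + 1)) ℂ →+* CoordRing σ.1) (P.isUnit_eval σ)) := by
  set F := awayEval (homogeneousSubmodule (Fin (m + 1)) ℂ)
      (P.eval σ : MvPolynomial (Fin (m + 1)) ℂ →+* CoordRing σ.1) (P.isUnit_eval σ) with hF
  have hconst : ∀ c : ℂ, algebraMap ℂ (CoordRing σ.1) c ∈ F.range := fun c =>
    ⟨HomogeneousLocalization.fromZeroRingHom _ _
      (algebraMap ℂ (homogeneousSubmodule (Fin (m + 1)) ℂ 0) c),
      (awayEval_fromZeroRingHom _ _ _ _).trans ((P.eval σ).commutes c)⟩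
  have hcoord : ∀ i, P.coord σ i ∈ F.range := fun i => by
    refine ⟨HomogeneousLocalization.Away.mk _ (X_mem (P.v σ)) 1 (X i) (by simpa using X_mem i), ?_⟩
    have h1 := awayEval_mk (homogeneousSubmodule (Fin (m + 1)) ℂ)
      (P.eval σ : MvPolynomial (Fin (m + 1)) ℂ →+* CoordRing σ.1) (P.isUnit_eval σ)
      (X_mem (P.v σ)) 1 (X i) (by simpa using X_mem i)
    have h2 : (P.eval σ : MvPolynomial (Fin (m + 1)) ℂ →+* CoordRing σ.1) (X (P.v σ)) = 1 :=
      (P.eval_X σ _).trans (P.coord_v σ)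
    rw [h2, one_pow, mul_one] at h1
    exact h1.trans (P.eval_X σ i)
  have hmono : ∀ k ∈ AddSubmonoid.closure (Set.range fun i => P.b i - P.b (P.v σ)),
      ∃ hk : k ∈ dualMonoid σ.1,
        (AddMonoidAlgebra.single (⟨k, hk⟩ : dualMonoid σ.1) (1 : ℂ) : CoordRing σ.1) ∈
          F.range := by
    intro k hk
    induction hk using AddSubmonoid.closure_induction with
    | mem k hk =>
      obtain ⟨i, rfl⟩ := hk
      exact ⟨P.sub_mem σ i, hcoord i⟩
    | zero => exact ⟨zero_mem _, F.range.one_mem⟩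
    | add k l _ _ hk hl =>
      obtain ⟨hk, hk'⟩ := hk
      obtain ⟨hl, hl'⟩ := hl
      refine ⟨add_mem hk hl, ?_⟩
      have := F.range.mul_mem hk' hl'
      rwa [AddMonoidAlgebra.single_mul_single, mul_one] at this
  intro z
  change z ∈ F.range
  induction z using AddMonoidAlgebra.induction_linear with
  | zero => exact F.range.zero_mem
  | add z w hz hw => exact F.range.add_mem hz hw
  | single k c =>
    obtain ⟨_, hk⟩ := hmono k.1 (P.generate σ k.2)
    have := F.range.mul_mem (hconst c) hk
    rw [← Algebra.smul_def, AddMonoidAlgebra.smul_single, smul_eq_mul, mul_one] at this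
    exact this

/-- The binomial of degree `N` in the ideal of the image of `X(Δ)` that comes from a relation
`N bᵢ = ∑ b_(v τ)` with `N` summands. -/
noncomputable def binomial (i : Fin (m + 1)) (w : Multiset Δ.Cone) :
    MvPolynomial (Fin (m + 1)) ℂ := X i ^ w.card - (w.map fun τ => X (P.v τ)).prod

theorem binomial_isHomogeneous (i : Fin (m + 1)) (w : Multiset Δ.Cone) :
    (P.binomial i w).IsHomogeneous w.card := by
  refine (isHomogeneous_X_pow i _).sub ?_
  induction w using Multiset.induction_on with
  | empty => simpa using isHomogeneous_one _ ℂ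
  | cons τ w ih =>
    rw [Multiset.map_cons, Multiset.prod_cons, Multiset.card_cons, add_comm w.card]
    exact (isHomogeneous_X ℂ _).mul ih

theorem eval_binomial (σ : Δ.Cone) {i : Fin (m + 1)} {w : Multiset Δ.Cone}
    (hw : w.card • P.b i = (w.map fun τ => P.b (P.v τ)).sum) :
    P.eval σ (P.binomial i w) = 0 := by
  have h : ∀ w : Multiset Δ.Cone, toTorusRing σ.1 (P.eval σ (w.map fun τ => X (P.v τ)).prod) =
      AddMonoidAlgebra.single
        ((w.map fun τ => P.b (P.v τ)).sum - w.card • P.b (P.v σ)) (1 : ℂ) := fun w => by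
    induction w using Multiset.induction_on with
    | empty =>
      rw [Multiset.map_zero, Multiset.prod_zero, map_one, map_one]
      simp [AddMonoidAlgebra.one_def]
    | cons τ w ih =>
      rw [Multiset.map_cons, Multiset.prod_cons, map_mul, map_mul, ih, eval_X, coord,
        Multiset.map_cons, Multiset.sum_cons, Multiset.card_cons]
      simp only [toTorusRing, AddMonoidAlgebra.mapDomainAlgHom_apply,
        AddMonoidAlgebra.mapDomain_single, AddMonoidAlgebra.single_mul_single, mul_one]
      congr 1
      change P.b (P.v τ) - P.b (P.v σ) + _ = _
      rw [add_smul, one_smul]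
      abel
  apply toTorusRing_injective
  rw [binomial, map_sub, map_sub, h, map_pow, map_pow, eval_X, coord, ← hw, ← smul_sub, map_zero]
  simp [toTorusRing, AddMonoidAlgebra.single_pow]

theorem iSup_basicOpen_X :
    ⨆ i, Proj.basicOpen (homogeneousSubmodule (Fin (m + 1)) ℂ) (X i) = ⊤ := by
  refine Proj.iSup_basicOpen_eq_top' _ _ (fun i => ⟨1, X_mem i⟩) (top_le_iff.1 fun p _ => ?_)
  induction p using MvPolynomial.induction_on with
  | C c =>
    exact Subalgebra.algebraMap_mem _
      (⟨C c, isHomogeneous_C _ c⟩ : homogeneousSubmodule (Fin (m + 1)) ℂ 0)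
  | add p q hp hq => exact add_mem (hp trivial) (hq trivial)
  | mul_X p i hp => exact mul_mem (hp trivial) (Algebra.subset_adjoin ⟨i, rfl⟩)

/-- The morphism to `ℙᵐ` is a closed immersion: over `D₊(x_(v σ))` it is the closed immersion of
the affine variety `U_σ` given by the generators of `S_σ`, and the other points of `ℙᵐ` have a
neighbourhood on which a binomial of the ideal of the image does not vanish. -/
theorem isClosedImmersion : IsClosedImmersion P.toProjectiveSpace := by
  choose w hw0 hw using P.convex
  let U : Δ.Cone ⊕ Fin (m + 1) → (projectiveSpace m).Opens := Sum.elim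
    (fun σ => Proj.basicOpen (homogeneousSubmodule (Fin (m + 1)) ℂ) (X (P.v σ)))
    (fun i => Proj.basicOpen (homogeneousSubmodule (Fin (m + 1)) ℂ) (P.binomial i (w i)))
  have hU : iSup U = ⊤ := by
    refine top_le_iff.1 fun x _ => TopologicalSpace.Opens.mem_iSup.2 ?_
    by_contra! H
    obtain ⟨i, hi⟩ := TopologicalSpace.Opens.mem_iSup.1
      (iSup_basicOpen_X (m := m) ▸ TopologicalSpace.Opens.mem_top x)
    let p : Ideal (MvPolynomial (Fin (m + 1)) ℂ) :=
      (show Proj (homogeneousSubmodule (Fin (m + 1)) ℂ) from x).asHomogeneousIdeal.toIdeal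
    have hp : p.IsPrime := (show Proj (homogeneousSubmodule (Fin (m + 1)) ℂ) from x).isPrime
    have hX : ∀ τ : Δ.Cone, (X (P.v τ) : MvPolynomial (Fin (m + 1)) ℂ) ∈ p := fun τ =>
      not_not.1 (H (Sum.inl τ))
    have hb : P.binomial i (w i) ∈ p := not_not.1 (H (Sum.inr i))
    obtain ⟨τ, hτ⟩ := Multiset.exists_mem_of_ne_zero (hw0 i)
    have hprod : ((w i).map fun τ => X (P.v τ)).prod ∈ p :=
      Ideal.mem_of_dvd _ (Multiset.dvd_prod (Multiset.mem_map_of_mem _ hτ)) (hX τ)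
    have hpow := p.add_mem hb hprod
    rw [binomial, sub_add_cancel] at hpow
    exact hi (hp.mem_of_pow_mem _ hpow)
  refine IsZariskiLocalAtTarget.of_iSup_eq_top U hU ?_
  rintro (σ | i)
  · exact isClosedImmersion_morphismRestrict _ P.toProjectiveSpace (Δ.chart σ) _ _ _ one_pos
      (P.chart_toProjectiveSpace σ) (P.preimage_basicOpen_X σ) (P.surjective_awayEval σ)
  · have : IsEmpty (P.toProjectiveSpace ⁻¹ᵁ U (Sum.inr i)).toScheme := by
      refine ⟨fun ⟨x, hx⟩ => ?_⟩
      obtain ⟨σ, y, rfl⟩ := Scheme.IsLocallyDirected.ι_jointly_surjective Δ.diagram x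
      have := (P.mem_preimage_basicOpen (P.binomial_isHomogeneous i (w i))
        (Multiset.card_pos.2 (hw0 i)) y).1 hx
      rw [P.eval_binomial σ (hw i), PrimeSpectrum.basicOpen_zero] at this
      exact this
    infer_instance

end ProjectiveEmbedding

theorem ProjectiveEmbedding.isProjective {Δ : Fan n} {m : ℕ} (P : ProjectiveEmbedding Δ m) :
    Δ.IsProjective :=
  ⟨m, P.toProjectiveSpace, P.isClosedImmersion, P.toProjectiveSpace_toSpec⟩

/-! ### Projectivity of the arrangement fan -/

section Arrangement

variable {ι : Type*} [Fintype ι]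

theorem exists_add_nsmul_cellVertex_sub_mem (a : ι → Fin n → ℤ) (s t : ι → SignType)
    {h : Fin n → ℤ} (hh : h ∈ dualMonoid (cell a s)) :
    ∃ N : ℕ, h + N • (cellVertex a s - cellVertex a t) ∈ dualMonoid (cell a t) := by
  refine exists_add_nsmul_mem (τ := cell a s ⊓ cell a t) (cell_isRational a t)
    (cellVertex_sub_mem_dualMonoid a t s) (fun x => ⟨fun hx => ⟨hx.2, ?_⟩,
      fun hx => ⟨mem_cell_of_cellVertex_sub hx.1 hx.2, hx.1⟩⟩) (dualMonoid_anti inf_le_left hh)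
  rw [cellVertex_sub_dotProduct s hx.2]
  exact Finset.sum_eq_zero fun i _ => sub_eq_zero.2 (abs_dotProduct_of_mem_cell hx.1 i)

/-- For large `K`, the generators of the monoids of the cells, translated to the vertices of the
`K`-fold zonotope, satisfy the inequalities of the zonotope. -/
theorem exists_nsmul_cellVertex (a : ι → Fin n → ℤ) (T : (ι → SignType) → Finset (Fin n → ℤ))
    (hT : ∀ s, ∀ h ∈ T s, h ∈ dualMonoid (cell a s)) :
    ∃ K : ℕ, 0 < K ∧ ∀ s t, ∀ h ∈ T s,
      K • cellVertex a s + h - K • cellVertex a t ∈ dualMonoid (cell a t) := by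
  classical
  have : ∀ s t h, ∃ N : ℕ, h ∈ T s →
      h + N • (cellVertex a s - cellVertex a t) ∈ dualMonoid (cell a t) := fun s t h => by
    by_cases hh : h ∈ T s
    · obtain ⟨N, hN⟩ := exists_add_nsmul_cellVertex_sub_mem a s t (hT s h hh)
      exact ⟨N, fun _ => hN⟩
    · exact ⟨0, fun h => absurd h hh⟩
  choose N hN using this
  refine ⟨(∑ s, ∑ t, ∑ h ∈ T s, N s t h) + 1, Nat.succ_pos _, fun s t h hh => ?_⟩
  have hle : N s t h ≤ (∑ s, ∑ t, ∑ h ∈ T s, N s t h) + 1 :=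
    ((Finset.single_le_sum (f := fun h => N s t h) (fun _ _ => Nat.zero_le _) hh).trans
      ((Finset.single_le_sum (f := fun t => ∑ h ∈ T s, N s t h) (fun _ _ => Nat.zero_le _)
        (Finset.mem_univ t)).trans
      (Finset.single_le_sum (f := fun s => ∑ t, ∑ h ∈ T s, N s t h) (fun _ _ => Nat.zero_le _)
        (Finset.mem_univ s)))).trans (Nat.le_succ _)
  obtain ⟨k, hk⟩ := Nat.exists_eq_add_of_le hle
  rw [hk]
  have := add_mem (hN s t h hh) (nsmul_mem (cellVertex_sub_mem_dualMonoid a t s) k)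
  convert this using 1
  rw [add_smul, add_smul, smul_sub, smul_sub]
  abel

theorem exists_multiset_map_sum_eq {α M : Type*} [AddCommMonoid M] (g : α → M) {y : M}
    (hy : y ∈ AddSubmonoid.closure (Set.range g)) : ∃ w : Multiset α, (w.map g).sum = y := by
  induction hy using AddSubmonoid.closure_induction with
  | mem y hy =>
    obtain ⟨x, rfl⟩ := hy
    exact ⟨{x}, by simp⟩
  | zero => exact ⟨0, by simp⟩
  | add y z _ _ hy hz =>
    obtain ⟨w, rfl⟩ := hy
    obtain ⟨w', rfl⟩ := hz
    exact ⟨w + w', by simp⟩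

/-- A point on which all functionals are at least their minimum over finitely many points lies in
the rational convex hull of these points. -/
theorem exists_multiset_card_nsmul_eq {α : Type*} [Finite α] (g : α → Fin n → ℤ) (b : Fin n → ℤ)
    (h : ∀ x : Fin n → ℤ, ∃ j, x ⬝ᵥ g j ≤ x ⬝ᵥ b) :
    ∃ w : Multiset α, w ≠ 0 ∧ w.card • b = (w.map g).sum := by
  -- the affine form of Farkas' lemma is the linear one for the points `(1, g j)` and `(1, b)`
  let lift : (Fin n → ℤ) → Fin (n + 1) → ℤ := Matrix.vecCons 1
  obtain ⟨N, hN, hmem⟩ := exists_nsmul_mem_closure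
    (Set.finite_range fun j => lift (g j)).toFinset (lift b) fun f hf => by
      obtain ⟨j, hj⟩ := h (Matrix.vecTail f)
      have := hf (lift (g j)) (by simp)
      simp only [lift, Matrix.dotProduct_cons] at this ⊢
      linarith
  rw [Set.Finite.coe_toFinset] at hmem
  obtain ⟨w, hw⟩ := exists_multiset_map_sum_eq _ hmem
  have hcomp : ∀ i, (w.map fun j => lift (g j) i).sum = N * lift b i := fun i => by
    have := congrArg (Pi.evalAddMonoidHom (fun _ => ℤ) i) hw
    rw [map_multiset_sum, Multiset.map_map] at this
    simpa using this
  have hcard : w.card = N := by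
    have := hcomp 0
    simp only [lift, Matrix.cons_val_zero, Multiset.map_const', Multiset.sum_replicate] at this
    simpa using this
  refine ⟨w, fun h0 => by simp [h0] at hcard; omega, ?_⟩
  ext i
  have := hcomp i.succ
  simp only [lift, Matrix.cons_val_succ] at this
  have e : (w.map g).sum i = (w.map fun j => g j i).sum := by
    have := map_multiset_sum (Pi.evalAddMonoidHom (fun _ : Fin n => ℤ) i) (w.map g)
    rwa [Multiset.map_map] at this
  rw [e, this, hcard]
  simp

/-- The fan of an arrangement is the normal fan of the zonotope `∑ᵢ [-aᵢ, aᵢ]`, so its toric variety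
is projective. It is embedded by the vertices of a large multiple of the zonotope, together with
the generators of the monoid of each cell translated to the vertex of this cell. -/
theorem arrangementFan_isProjective (a : ι → Fin n → ℤ)
    (ha : ∀ x : Fin n → ℝ, (∀ i, toReal (a i) ⬝ᵥ x = 0) → x = 0) :
    (arrangementFan a ha).IsProjective := by
  classical
  choose T hT using fun s => (cell_isRational a s).exists_closure_eq_dualMonoid
  obtain ⟨K, hK, hKT⟩ := exists_nsmul_cellVertex a (fun s => insert 0 (T s)) fun s h hh => by
    rcases Finset.mem_insert.1 hh with rfl | hh
    · exact zero_mem _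
    · exact hT s ▸ AddSubmonoid.subset_closure hh
  let B : Finset (Fin n → ℤ) := Finset.univ.biUnion fun s : ι → SignType =>
    (insert 0 (T s)).image fun h => K • cellVertex a s + h
  have hB : ∀ s, ∀ h ∈ insert 0 (T s), K • cellVertex a s + h ∈ B := fun s h hh =>
    Finset.mem_biUnion.2 ⟨s, Finset.mem_univ _, Finset.mem_image_of_mem _ hh⟩
  have hv : ∀ s, K • cellVertex a s ∈ B := fun s => by
    simpa using hB s 0 (Finset.mem_insert_self _ _)
  obtain ⟨m, hm⟩ := Nat.exists_eq_succ_of_ne_zero (Finset.card_ne_zero_of_mem (hv 0))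
  let e : B ≃ Fin (m + 1) := B.equivFinOfCardEq hm
  let sgn : (arrangementFan a ha).Cone → ι → SignType := fun σ => σ.2.choose
  have hsgn : ∀ σ, cell a (sgn σ) = σ.1 := fun σ => σ.2.choose_spec
  let v : (arrangementFan a ha).Cone → Fin (m + 1) := fun σ => e ⟨_, hv (sgn σ)⟩
  have hbv : ∀ σ, (e.symm (v σ)).1 = K • cellVertex a (sgn σ) := fun σ => by
    simp only [v, e.symm_apply_apply]
  have hsub : ∀ σ i, (e.symm i).1 - (e.symm (v σ)).1 ∈ dualMonoid σ.1 := fun σ i => by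
    obtain ⟨s, -, hs⟩ := Finset.mem_biUnion.1 (e.symm i).2
    obtain ⟨h, hh, hi⟩ := Finset.mem_image.1 hs
    rw [hbv, ← hi, ← hsgn σ]
    exact hKT s (sgn σ) h hh
  have : Finite (arrangementFan a ha).Cone := (arrangementFan a ha).finite.to_subtype
  exact ProjectiveEmbedding.isProjective
    { b := fun i => (e.symm i).1
      v := v
      sub_mem := hsub
      generate := fun σ => by
        rw [← hsgn σ, ← hT, AddSubmonoid.closure_le]
        intro h hh
        refine AddSubmonoid.subset_closure
          ⟨e ⟨_, hB (sgn σ) h (Finset.mem_insert_of_mem hh)⟩, ?_⟩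
        simp only [hbv, e.symm_apply_apply, add_sub_cancel_left]
      separate := fun σ τ x hx h0 => by
        rw [hbv, hbv, ← smul_sub, toReal_nsmul, smul_dotProduct, smul_eq_mul, mul_eq_zero] at h0
        rw [← hsgn σ] at hx
        rw [← hsgn τ]
        exact mem_cell_of_cellVertex_sub hx
          (h0.resolve_left (Nat.cast_ne_zero.2 hK.ne'))
      convex := fun i => exists_multiset_card_nsmul_eq _ _ fun x => by
        let σ : (arrangementFan a ha).Cone := ⟨_, fun i => SignType.sign (a i ⬝ᵥ x), rfl⟩
        refine ⟨σ, ?_⟩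
        have := hsub σ i _ (toReal_mem_cell (mem_cellPoints_sign a x))
        rw [toReal_dotProduct, sub_dotProduct] at this
        rw [dotProduct_comm x, dotProduct_comm x]
        have h : (0 : ℤ) ≤ (e.symm i).1 ⬝ᵥ x - (e.symm (v σ)).1 ⬝ᵥ x := by exact_mod_cast this
        linarith }

end Arrangement

/-- If the pullback by `A` of each equation of the arrangement is, up to positive factors, again an
equation of the arrangement, then `A` maps cells into cells. -/
theorem exists_mapsInto_cell {ι : Type*} {a : ι → Fin n → ℤ} {A : Matrix (Fin n) (Fin n) ℤ}
    (hA : ∀ i, ∃ j, ∃ c d : ℤ, 0 < c ∧ 0 < d ∧ c • Matrix.vecMul (a i) A = d • a j)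
    (s : ι → SignType) : ∃ t, MapsInto A (cell a s) (cell a t) := by
  choose j c d hc hd hcd using hA
  refine ⟨fun i => s (j i), fun x hx => ?_⟩
  refine Submodule.span_induction
    (p := fun x _ => (A.map (Int.cast : ℤ → ℝ)).mulVec x ∈ cell a fun i => s (j i)) ?_ ?_ ?_ ?_ hx
  · rintro _ ⟨v, hv, rfl⟩
    rw [mulVec_toReal]
    refine toReal_mem_cell fun i => ?_
    have h := congrArg (· ⬝ᵥ v) (hcd i)
    simp only [smul_dotProduct, smul_eq_mul, ← Matrix.dotProduct_mulVec] at h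
    have h1 := hv (j i)
    refine mul_left_cancel₀ (hc i).ne' ?_
    calc c i * |a i ⬝ᵥ A.mulVec v| = |c i * (a i ⬝ᵥ A.mulVec v)| := by
          rw [abs_mul, abs_of_pos (hc i)]
      _ = d i * |a (j i) ⬝ᵥ v| := by rw [h, abs_mul, abs_of_pos (hd i)]
      _ = s (j i) * (d i * (a (j i) ⬝ᵥ v)) := by rw [h1]; ring
      _ = c i * (s (j i) * (a i ⬝ᵥ A.mulVec v)) := by rw [← h]; ring
  · rw [Matrix.mulVec_zero]
    exact zero_mem _
  · intro x y _ _ hx hy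
    rw [Matrix.mulVec_add]
    exact add_mem hx hy
  · intro r x _ hx
    have : (A.map (Int.cast : ℤ → ℝ)).mulVec (r • x) =
        r • (A.map (Int.cast : ℤ → ℝ)).mulVec x :=
      Matrix.mulVec_smul (A.map (Int.cast : ℤ → ℝ)) (r : ℝ) x
    rw [this]
    exact Submodule.smul_mem _ r hx

/-! ### Monoids of matrices that are finite modulo positive scalars -/

theorem exists_smul_eq_of_proj_eq {A B : nonsingular n} (h : proj n A = proj n B) :
    ∃ c d : ℤ, 0 < c ∧ 0 < d ∧ c • A.1 = d • B.1 := by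
  obtain ⟨q, hq, hqAB⟩ := QuotientGroup.eq.1 h
  have hq : 0 < (q : ℚ) := hq
  have h1 : nonsingularToGL n A * Matrix.GeneralLinearGroup.scalar (Fin n) q =
      nonsingularToGL n B := by
    rw [hqAB, mul_inv_cancel_left]
  refine ⟨(q : ℚ).num, (q : ℚ).den, Rat.num_pos.2 hq, by exact_mod_cast (q : ℚ).den_pos, ?_⟩
  ext i k
  have h2 : (A.1 i k : ℚ) * q = B.1 i k := by
    have := congrArg (fun g : Matrix.GeneralLinearGroup (Fin n) ℚ => g.1 i k) h1
    have h3 : (nonsingularToGL n A * Matrix.GeneralLinearGroup.scalar (Fin n) q).1 i k =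
        (nonsingularToGL n A).1 i k * q := by
      simp [Matrix.GeneralLinearGroup.scalar]
    exact h3.symm.trans this
  rw [← Rat.num_div_den (q : ℚ)] at h2
  have hden : ((q : ℚ).den : ℚ) ≠ 0 := by exact_mod_cast (q : ℚ).den_pos.ne'
  field_simp at h2
  simp only [Matrix.smul_apply, smul_eq_mul]
  have h4 : (((q : ℚ).num * A.1 i k : ℤ) : ℚ) = (((q : ℚ).den : ℤ) * B.1 i k : ℤ) := by
    push_cast
    linarith
  exact_mod_cast h4

/-- There is a finite set of integral functionals that contains the coordinates and generators of
`σ^∨ ∩ M` for each cone `σ` of `Δ`, and that is invariant under `G` up to positive multiples: a set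
with the first two properties is pulled back along representatives of the classes in `p(G)`. -/
theorem exists_finite_invariant (Δ : Fan n) (G : Submonoid (nonsingular n))
    (hG : (proj n '' (G : Set (nonsingular n))).Finite) :
    ∃ H : Set (Fin n → ℤ), H.Finite ∧ (∀ i, Pi.single i 1 ∈ H) ∧
      (∀ σ ∈ Δ.cones, ∃ T ⊆ H, AddSubmonoid.closure T = dualMonoid σ) ∧
      ∀ A ∈ G, ∀ m ∈ H, ∃ m' ∈ H, ∃ c d : ℤ, 0 < c ∧ 0 < d ∧
        c • Matrix.vecMul m A.1 = d • m' := by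
  obtain ⟨R, hRG, hR⟩ := Set.exists_subset_bijOn (G : Set (nonsingular n)) (proj n)
  have hRfin : R.Finite := hR.finite_iff_finite.2 hG
  choose T hT using fun σ : Δ.Cone => (Δ.rational σ.1 σ.2).exists_closure_eq_dualMonoid
  have : Finite Δ.Cone := Δ.finite.to_subtype
  let H₀ : Set (Fin n → ℤ) := Set.range (fun i => Pi.single i 1) ∪ ⋃ σ, (T σ : Set (Fin n → ℤ))
  have hH₀ : H₀.Finite :=
    (Set.finite_range _).union (Set.finite_iUnion fun σ => (T σ).finite_toSet)
  have hsub : H₀ ⊆ Set.image2 (fun r m => Matrix.vecMul m r.1) (insert 1 R) H₀ := fun m hm =>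
    ⟨1, Set.mem_insert _ _, m, hm, Matrix.vecMul_one m⟩
  -- `1` is added to the representatives in order that the set contains `H₀`
  refine ⟨_, (hRfin.insert 1).image2 _ hH₀, fun i => hsub (Or.inl ⟨i, rfl⟩), fun σ hσ =>
    ⟨T ⟨σ, hσ⟩, fun m hm => hsub (Or.inr (Set.mem_iUnion.2 ⟨_, hm⟩)), hT ⟨σ, hσ⟩⟩, ?_⟩
  rintro A hA _ ⟨r, hr, m, hm, rfl⟩
  have hrG : r ∈ G := by
    rcases hr with rfl | hr
    exacts [G.one_mem, hRG hr]
  obtain ⟨r', hr', hproj⟩ := hR.surjOn ⟨r * A, G.mul_mem hrG hA, rfl⟩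
  obtain ⟨c, d, hc, hd, hcd⟩ := exists_smul_eq_of_proj_eq hproj.symm
  refine ⟨Matrix.vecMul m r'.1, ⟨r', Set.mem_insert_of_mem _ hr', m, hm, rfl⟩, c, d, hc, hd, ?_⟩
  have := congrArg (Matrix.vecMul m) hcd
  rw [Matrix.vecMul_smul, Matrix.vecMul_smul] at this
  rw [Matrix.vecMul_vecMul]
  exact this

end Toric

theorem mainTheorem9 (n : ℕ) (Δ : Toric.Fan n) (hΔ : Δ.IsComplete)
    (G : Submonoid (Toric.nonsingular n))
    (hG : (Toric.proj n '' (G : Set (Toric.nonsingular n))).Finite) :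
    ∃ (Δ' : Toric.Fan n) (π : Δ'.variety ⟶ Δ.variety) (e : Δ'.variety.PartialIso Δ.variety),
      Δ'.IsProjective ∧
      π ≫ Δ.toSpec = Δ'.toSpec ∧
      Δ'.torusι ≫ π = Δ.torusι ∧
      e.toRationalMap = π.toRationalMap ∧
      ∀ A ∈ G, ∃ g : Δ'.variety ⟶ Δ'.variety,
        g ≫ Δ'.toSpec = Δ'.toSpec ∧
        Toric.IsEquivariant A.1 g ∧
        (e.toRationalMap.comp (Δ.monomialMap A.1)).comp e.symm.toRationalMap =
          g.toRationalMap := by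
  obtain ⟨H, hHfin, hHunit, hHΔ, hHG⟩ := Toric.exists_finite_invariant Δ G hG
  have := hHfin.fintype
  let a : H → Fin n → ℤ := Subtype.val
  have ha : ∀ x : Fin n → ℝ, (∀ i, Toric.toReal (a i) ⬝ᵥ x = 0) → x = 0 := fun x hx => by
    ext i
    have h1 : Toric.toReal (Pi.single i 1 : Fin n → ℤ) = Pi.single i 1 := by
      ext k
      simp [Toric.toReal, Pi.single_apply]
    have h2 := hx ⟨_, hHunit i⟩
    simpa [a, h1] using h2
  let Δ' := Toric.arrangementFan a ha
  have hπ : Toric.IsFanMap 1 Δ' Δ := by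
    rintro ⟨_, s, rfl⟩
    obtain ⟨σ, hσ, hs⟩ := Toric.exists_cell_le (a := a) hΔ
      (fun σ hσ => by simpa only [a, Subtype.range_coe] using hHΔ σ hσ) s
    refine ⟨⟨σ, hσ⟩, fun x hx => ?_⟩
    rw [Matrix.map_one _ Int.cast_zero Int.cast_one, Matrix.one_mulVec]
    exact hs hx
  have hg : ∀ A ∈ G, Toric.IsFanMap A.1 Δ' Δ' := by
    rintro A hA ⟨_, s, rfl⟩
    obtain ⟨t, ht⟩ := Toric.exists_mapsInto_cell (a := a) (A := A.1) (fun i => by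
      obtain ⟨m', hm', h⟩ := hHG A hA i.1 i.2
      exact ⟨⟨m', hm'⟩, h⟩) s
    exact ⟨⟨_, t, rfl⟩, ht⟩
  have hπT : Δ'.torusι ≫ hπ.map = Δ.torusι := by
    rw [hπ.torusι_map, Toric.monomialTorus_one, Category.id_comp]
  refine ⟨Δ', hπ.map, Toric.partialIsoOfDominant Δ'.torusι Δ.torusι,
    Toric.arrangementFan_isProjective a ha, hπ.map_toSpec, hπT, ?_, fun A hA =>
      ⟨(hg A hA).map, (hg A hA).map_toSpec, (hg A hA).isEquivariant, ?_⟩⟩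
  · rw [Toric.partialIsoOfDominant_toRationalMap, ← hπT, Toric.partialIso_symm_compHom_comp]
  · exact Toric.conj_partialIsoOfDominant Δ'.torusι Δ.torusι (Toric.monomialTorus A.1)
      (F := Δ.monomialMap A.1) rfl (hg A hA).torusι_map
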